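/- **Setting.** Let $X\in\mathbb R^{n\times p}$ ($n,p\ge 1$) be a fixed design, $\beta^*\in\mathbb R^p$, $\sigma\ge 0$, and $y=X\beta^*+w$ with $w\sim\mathcal N(0,\sigma^2I_n)$. Let $S=\{i:\beta^*_i\neq 0\}$, $s=|S|$, $$S_1=\Big\{i\in S:\ |\beta^*_i|\ge 2\sigma\log p\sqrt{\tfrac{\log p}{n}}\Big\},\qquad S_2=\Big\{i\in S:\ |\beta^*_i|\le 2\sigma\sqrt{\tfrac{\log p}{n}}\Big\},$$ $s_1=|S_1|$, $s_2=|S_2|$, and assume $S_1\neq\emptyset$. Let $m$ be the $s_1$-th largest of the values $|\beta^*_i|$ and $\kappa=\max_i|\beta^*_i|/m$. The matrix $X$ has the $(k,\delta)$-restricted isometry property (RIP) if $(1-\delta)\|u\|^2\le n^{-1}\|Xu\|^2\le(1+\delta)\|u\|^2$ for every $u\in\mathbb R^p$ with at most $k$ nonzero components. Gradient descent with step size $\eta$ and initialization level $\alpha$ is: $g_0=\alpha\mathbf 1$, $l_0=\mathbf 0$, $$g_{t+1}=g_t-\eta\, l_t\circ\big[n^{-1}X^T(X(g_t\circ l_t)-y)\big],\qquad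 l_{t+1}=l_t-\eta\, g_t\circ\big[n^{-1}X^T(X(g_t\circ l_t)-y)\big],$$ where $\circ$ is the componentwise product. Put $\beta_t=g_t\circ l_t$ and $\tau=\max\{\delta\alpha,\ \sigma\sqrt{\log p/n}\}$. **Theorem (variable selection consistency).** For every $C>0$ there are positive constants $c_\delta,c_\alpha,c_\eta,\tilde c_1,\tilde c_2,\tilde c_3,\tilde c_4,\tilde c_{10},\tilde c_{11}$, depending only on $C$, such that the following holds for all $n,p,X,\beta^*,\sigma,\delta,\alpha,\eta$ as above satisfying * (A) $S=S_1\cup S_2$, $s=s_1+s_2$, and $\kappa m\le C$; * (B) $X$ satisfies the $(s+1,\delta)$-RIP with $\delta\le c_\delta/\big(\kappa\sqrt s\,\log\frac p\alpha\big)$; * (C) $0<\alpha\le c_\alpha/p$ and $0<\eta\le c_\eta/\big(\kappa\log\frac p\alpha\big)$. For every $t\in\mathbb N$ with $\tilde c_1\log(\frac p\alpha)/(\eta m)\le t\le \tilde c_2/(\eta\tau)$ (no upper limit if $\tau=0$), with probability at least $1-p^{-\tilde c_3}-n^{-\tilde c_4}$ the following holds: for every $\lambda\in\big[\tilde c_{10}/p,\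 \tilde c_{11}\sigma\sqrt{\log p/n}\,\big]$, the hard-thresholded estimator $$\beta'_{t,j}=\begin{cases}\beta_{t,j},&|\beta_{t,j}|\ge\lambda,\\ 0,&|\beta_{t,j}|<\lambda,\end{cases}\qquad j=1,\dots,p,$$ satisfies $\{j:\ \beta'_{t,j}\ne 0\}=S_1$. -/

import Mathlib

open MeasureTheory ProbabilityTheory
open scoped Matrix

/-- The support `{j : u_j ≠ 0}` of a vector. -/
noncomputable def vecSupport {p : ℕ} (u : Fin p → ℝ) : Finset (Fin p) :=
  Finset.univ.filter fun j => u j ≠ 0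

/-- The strong signals: nonzero components with `|β_i| ≥ 2 σ (log p) √(log p / n)`. -/
noncomputable def strongSignals (n : ℕ) {p : ℕ} (σ : ℝ) (β : Fin p → ℝ) : Finset (Fin p) :=
  (vecSupport β).filter fun i =>
    2 * σ * Real.log p * Real.sqrt (Real.log p / n) ≤ |β i|

/-- The weak signals: nonzero components with `|β_i| ≤ 2 σ √(log p / n)`. -/
noncomputable def weakSignals (n : ℕ) {p : ℕ} (σ : ℝ) (β : Fin p → ℝ) : Finset (Fin p) :=
  (vecSupport β).filter fun i => |β i| ≤ 2 * σ * Real.sqrt (Real.log p / n)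

/-- The `k`-th largest absolute component `θ_k(β)` (for `1 ≤ k ≤ p`): the greatest level which at
least `k` components reach in absolute value. -/
noncomputable def kthLargestAbs {p : ℕ} (k : ℕ) (β : Fin p → ℝ) : ℝ :=
  sSup {x : ℝ | k ≤ (Finset.univ.filter fun i => x ≤ |β i|).card}

/-- For `1 ≤ k ≤ p` the supremum in the definition of `θ_k(β)` is attained. -/
theorem kthLargestAbs_isGreatest {p : ℕ} {k : ℕ} (hk : 1 ≤ k) (hkp : k ≤ p) (β : Fin p → ℝ) :
    IsGreatest {x : ℝ | k ≤ (Finset.univ.filter fun i => x ≤ |β i|).card}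
      (kthLargestAbs k β) := by
  set A : Set ℝ := {x : ℝ | k ≤ (Finset.univ.filter fun i => x ≤ |β i|).card} with hA
  -- the levels in `A` that are values of `|β|`
  have up : ∀ x ∈ A, ∃ i, x ≤ |β i| ∧ |β i| ∈ A := by
    intro x hx
    have hne : (Finset.univ.filter fun i => x ≤ |β i|).Nonempty := by
      rw [← Finset.card_pos]
      exact lt_of_lt_of_le hk hx
    obtain ⟨i, hi, hmin⟩ := Finset.exists_min_image _ (fun i => |β i|) hne
    refine ⟨i, (Finset.mem_filter.1 hi).2, ?_⟩
    refine le_trans hx (Finset.card_le_card ?_)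
    intro j hj
    exact Finset.mem_filter.2 ⟨Finset.mem_univ _, hmin j hj⟩
  have h0 : (0 : ℝ) ∈ A := by
    simpa [hA] using hkp
  obtain ⟨i0, -, hi0⟩ := up 0 h0
  have hne : (Finset.univ.filter fun i => |β i| ∈ A).Nonempty := by
    classical
    exact ⟨i0, Finset.mem_filter.2 ⟨Finset.mem_univ _, hi0⟩⟩
  obtain ⟨j, hj, hmax⟩ := Finset.exists_max_image _ (fun i => |β i|) hne
  have hg : IsGreatest A |β j| := by
    refine ⟨(Finset.mem_filter.1 hj).2, ?_⟩
    intro x hx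
    obtain ⟨i, hxi, hi⟩ := up x hx
    exact hxi.trans (hmax i (Finset.mem_filter.2 ⟨Finset.mem_univ _, hi⟩))
  have : kthLargestAbs k β = |β j| := hg.csSup_eq
  rw [this]
  exact hg

/-- The minimal strength `m = θ_{s₁}(β)` of the strong signals, where `s₁ = |S₁|`. -/
noncomputable def minStrength (n : ℕ) {p : ℕ} (σ : ℝ) (β : Fin p → ℝ) : ℝ :=
  kthLargestAbs (strongSignals n σ β).card β

/-- The strong-signal condition number `κ`: largest absolute signal over smallest strong signal. -/
noncomputable def condNumber (n : ℕ) {p : ℕ} (σ : ℝ) (β : Fin p → ℝ) : ℝ :=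
  (⨆ i, |β i|) / minStrength n σ β

/-- The `(k, δ)`-restricted isometry property:
`(1 - δ)‖u‖² ≤ n⁻¹ ‖X u‖² ≤ (1 + δ)‖u‖²` for all `k`-sparse `u`, with Euclidean norms. -/
def RIP {n p : ℕ} (X : Matrix (Fin n) (Fin p) ℝ) (k : ℕ) (δ : ℝ) : Prop :=
  ∀ u : Fin p → ℝ, (vecSupport u).card ≤ k →
    (1 - δ) * ∑ j, u j ^ 2 ≤ (1 / (n : ℝ)) * ∑ i, (X *ᵥ u) i ^ 2 ∧
      (1 / (n : ℝ)) * ∑ i, (X *ᵥ u) i ^ 2 ≤ (1 + δ) * ∑ j, u j ^ 2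

/-- The vector `n⁻¹ Xᵀ (X (g ∘ l) - y)`. -/
noncomputable def residualGrad {n p : ℕ} (X : Matrix (Fin n) (Fin p) ℝ) (y : Fin n → ℝ)
    (g l : Fin p → ℝ) : Fin p → ℝ :=
  (1 / (n : ℝ)) • (Xᵀ *ᵥ (X *ᵥ (g * l) - y))

/-- Gradient descent iterates `(g_t, l_t)` for `f(g, l) = (2n)⁻¹ ‖X (g ∘ l) - y‖²` with step size
`η`, started from `g₀ = α 𝟏`, `l₀ = 0`. Products of vectors are componentwise. -/
noncomputable def gdIterate {n p : ℕ} (X : Matrix (Fin n) (Fin p) ℝ) (y : Fin n → ℝ) (α η : ℝ) :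
    ℕ → (Fin p → ℝ) × (Fin p → ℝ)
  | 0 => (fun _ => α, fun _ => 0)
  | t + 1 =>
      let g := (gdIterate X y α η t).1
      let l := (gdIterate X y α η t).2
      (g - η • (l * residualGrad X y g l), l - η • (g * residualGrad X y g l))

/-- The estimator `β_t = g_t ∘ l_t`. -/
noncomputable def gdEstimator {n p : ℕ} (X : Matrix (Fin n) (Fin p) ℝ) (y : Fin n → ℝ) (α η : ℝ)
    (t : ℕ) : Fin p → ℝ :=
  (gdIterate X y α η t).1 * (gdIterate X y α η t).2

/-- Componentwise hard thresholding at level `lam`. -/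
noncomputable def hardThreshold {p : ℕ} (lam : ℝ) (β : Fin p → ℝ) : Fin p → ℝ :=
  fun j => if lam ≤ |β j| then β j else 0

/-- The Gaussian law `N(0, σ² I)` on `ℝⁿ`. -/
noncomputable def gaussianNoise (n : ℕ) (σ : ℝ) : Measure (Fin n → ℝ) :=
  Measure.pi fun _ => gaussianReal 0 ⟨σ ^ 2, sq_nonneg σ⟩

/-- The quantity `τ = max {δ α, σ √(log p / n)}` limiting the number of iterations. -/
noncomputable def tauLevel (n p : ℕ) (σ δ α : ℝ) : ℝ :=
  max (δ * α) (σ * Real.sqrt (Real.log p / n))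

/-!
In the coordinates `x = g + l`, `z = g - l` one has `β = (x² - z²) / 4`, and a gradient step with
gradient `r` multiplies `x` by `1 - η r` and `z` by `1 + η r`. By the restricted isometry property
`r` is the deviation of `β` from the strong signals up to a perturbation `ε D + O(τ)`, where `D` is
the current error on the strong signals and `ε = δ √s`. A strong coordinate of `β` therefore grows
geometrically at a rate of order `η m` until it is comparable with its target, after about
`log (p / α) / (η m)` steps, and from then on its error contracts down to the level of the noise.
Summed over the whole window the perturbations stay below a constant, so the factors of all the
other coordinates never exceed a constant times `α`, and the corresponding `β` stay below
`2 α² < 1 / p`.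
The Gaussian noise enters only through `n⁻¹ Xᵀ w`, which is uniformly of order `σ √(log p / n)` by a
union bound.
-/

/-- The product `g * l` of a pair of factors, in the coordinates `z = (g + l, g - l)`: in these a
step of gradient descent multiplies each entry by a scalar. -/
noncomputable def hadamardValue (z : ℝ × ℝ) : ℝ := (z.1 ^ 2 - z.2 ^ 2) / 4

/-- The sum of squares `g ^ 2 + l ^ 2` of a pair of factors, in the coordinates
`z = (g + l, g - l)`: the speed at which the product `g * l` follows a gradient. -/
noncomputable def hadamardRate (z : ℝ × ℝ) : ℝ := (z.1 ^ 2 + z.2 ^ 2) / 2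

/-- A gradient descent step of size `η` on a pair of factors `z = (g + l, g - l)`, where `r` is the
derivative of the loss in the product `g * l`. -/
def hadamardStep (η r : ℝ) (z : ℝ × ℝ) : ℝ × ℝ := (z.1 * (1 - η * r), z.2 * (1 + η * r))

section CoordinateDynamics

variable {α η θ e m G A E D : ℝ} {z : ℝ × ℝ}

lemma hadamardRate_nonneg (z : ℝ × ℝ) : 0 ≤ hadamardRate z := by
  unfold hadamardRate; positivity

lemma abs_hadamardValue_le (z : ℝ × ℝ) : |hadamardValue z| ≤ hadamardRate z / 2 := by
  rw [abs_le, hadamardValue, hadamardRate]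
  constructor <;> nlinarith [sq_nonneg z.1, sq_nonneg z.2]

lemma hadamardValue_swap (z : ℝ × ℝ) : hadamardValue z.swap = -hadamardValue z := by
  simp only [hadamardValue, Prod.fst_swap, Prod.snd_swap]; ring

lemma hadamardStep_swap (η r : ℝ) (z : ℝ × ℝ) :
    (hadamardStep η r z).swap = hadamardStep η (-r) z.swap := by
  ext <;> simp [hadamardStep, sub_eq_add_neg]

lemma hadamardValue_step (η r : ℝ) (z : ℝ × ℝ) :
    hadamardValue (hadamardStep η r z) =
      hadamardValue z - η * r * hadamardRate z + hadamardValue z * (η * r) ^ 2 := by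
  simp only [hadamardValue, hadamardRate, hadamardStep]; ring

lemma hadamardStep_mul_le (η r : ℝ) (hz : 0 ≤ z.1 * z.2) :
    (hadamardStep η r z).1 * (hadamardStep η r z).2 ≤ z.1 * z.2 :=
  calc z.1 * (1 - η * r) * (z.2 * (1 + η * r)) = z.1 * z.2 * (1 - (η * r) ^ 2) := by ring
    _ ≤ z.1 * z.2 := mul_le_of_le_one_right hz (by linarith [sq_nonneg (η * r)])

lemma abs_hadamardValue_step_sub_le (hη : 0 ≤ η) (hrate : η * hadamardRate z ≤ 1)
    (hr : |η * (hadamardValue z - θ + e)| ≤ 1 / 500) :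
    |hadamardValue (hadamardStep η (hadamardValue z - θ + e) z) - θ| ≤
      (1 - 9 / 10 * (η * hadamardRate z)) * |hadamardValue z - θ| +
        11 / 10 * (η * hadamardRate z) * |e| := by
  set v := hadamardValue z
  set x := η * hadamardRate z with hx
  have hx0 : 0 ≤ x := mul_nonneg hη (hadamardRate_nonneg z)
  have second_order : |v * (η * (v - θ + e)) ^ 2| ≤ x / 1000 * (|v - θ| + |e|) :=
    calc |v * (η * (v - θ + e)) ^ 2|
        = |v| * (|η * (v - θ + e)| * (η * |v - θ + e|)) := by
          rw [abs_mul, abs_pow, sq, abs_mul η, abs_of_nonneg hη]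
      _ ≤ hadamardRate z / 2 * (1 / 500 * (η * (|v - θ| + |e|))) := by
          gcongr
          · exact div_nonneg (hadamardRate_nonneg z) two_pos.le
          · exact abs_hadamardValue_le z
          · exact abs_add_le _ _
      _ = x / 1000 * (|v - θ| + |e|) := by rw [hx]; ring
  have expansion : hadamardValue (hadamardStep η (v - θ + e) z) - θ =
      (1 - x) * (v - θ) + (-(x * e) + v * (η * (v - θ + e)) ^ 2) := by
    rw [hadamardValue_step, hx]; ring
  calc |hadamardValue (hadamardStep η (v - θ + e) z) - θ|
      ≤ |(1 - x) * (v - θ)| + (|-(x * e)| + |v * (η * (v - θ + e)) ^ 2|) := by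
        rw [expansion]
        exact (abs_add_le _ _).trans (by gcongr; exact abs_add_le _ _)
    _ ≤ (1 - x) * |v - θ| + (x * |e| + x / 1000 * (|v - θ| + |e|)) := by
        rw [abs_mul, abs_neg, abs_mul x, abs_of_nonneg hx0, abs_of_nonneg (sub_nonneg.2 hrate)]
        gcongr
    _ ≤ (1 - 9 / 10 * x) * |v - θ| + 11 / 10 * x * |e| := by
        nlinarith [mul_nonneg hx0 (abs_nonneg (v - θ)), mul_nonneg hx0 (abs_nonneg e)]

lemma abs_hadamardValue_step_sub_le_of_le (hη : 0 ≤ η) (hrate : η * hadamardRate z ≤ 1)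
    (hr : |η * (hadamardValue z - θ + e)| ≤ 1 / 500) (hD : |hadamardValue z - θ| ≤ D)
    (he : |e| ≤ D / 8) :
    |hadamardValue (hadamardStep η (hadamardValue z - θ + e) z) - θ| ≤ D := by
  have hx0 : 0 ≤ η * hadamardRate z := mul_nonneg hη (hadamardRate_nonneg z)
  have hD0 : 0 ≤ D := (abs_nonneg _).trans hD
  calc |hadamardValue (hadamardStep η (hadamardValue z - θ + e) z) - θ|
      ≤ (1 - 9 / 10 * (η * hadamardRate z)) * D + 11 / 10 * (η * hadamardRate z) * (D / 8) := by
        refine (abs_hadamardValue_step_sub_le hη hrate hr).trans ?_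
        gcongr
        linarith
    _ ≤ D := by nlinarith [mul_nonneg hx0 hD0]

/-- The state of a pair of factors, started from `(α, α)`, whose product is driven to `θ > 0`: the
product is at least half of the target, or else the leading factor has grown to the level `G`. -/
structure StrongState (α θ G : ℝ) (z : ℝ × ℝ) : Prop where
  fst_pos : 0 < z.1
  snd_pos : 0 < z.2
  mul_le : z.1 * z.2 ≤ α ^ 2
  value_nonneg : 0 ≤ hadamardValue z
  value_le : hadamardValue z ≤ 3 / 2 * θ
  half_le_or : θ / 2 ≤ hadamardValue z ∨ G ≤ z.1

namespace StrongState

lemma init (hα : 0 < α) (hθ : 0 ≤ θ) : StrongState α θ α (α, α) where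
  fst_pos := hα
  snd_pos := hα
  mul_le := (sq α).ge
  value_nonneg := by simp [hadamardValue]
  value_le := by simpa [hadamardValue] using hθ
  half_le_or := Or.inr le_rfl

lemma abs_value_sub_le (h : StrongState α θ G z) : |hadamardValue z - θ| ≤ θ := by
  rw [abs_le]; constructor <;> linarith [h.value_nonneg, h.value_le]

lemma snd_sq_le (h : StrongState α θ G z) : z.2 ^ 2 ≤ α ^ 2 := by
  have snd_le_fst : z.2 ≤ z.1 := by
    refine (pow_le_pow_iff_left₀ h.snd_pos.le h.fst_pos.le two_ne_zero).1 ?_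
    have := h.value_nonneg
    rw [hadamardValue] at this
    linarith
  calc z.2 ^ 2 = z.2 * z.2 := sq _
    _ ≤ z.1 * z.2 := mul_le_mul_of_nonneg_right snd_le_fst h.snd_pos.le
    _ ≤ α ^ 2 := h.mul_le

lemma half_le (h : StrongState α θ G z) (hG0 : 0 ≤ G) (hG : 2 * θ + α ^ 2 ≤ G ^ 2) :
    θ / 2 ≤ hadamardValue z := by
  refine h.half_le_or.elim id fun hle => ?_
  have : G ^ 2 ≤ z.1 ^ 2 := pow_le_pow_left₀ hG0 hle 2
  rw [hadamardValue]
  linarith [h.snd_sq_le]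

lemma rate_le (h : StrongState α θ G z) (hαθ : α ^ 2 ≤ θ) : hadamardRate z ≤ 4 * θ := by
  have rate_eq : hadamardRate z = 2 * hadamardValue z + z.2 ^ 2 := by
    rw [hadamardRate, hadamardValue]; ring
  linarith [h.value_le, h.snd_sq_le]

lemma mul_rate_le (h : StrongState α θ G z) (hη : 0 ≤ η) (hαθ : α ^ 2 ≤ θ)
    (hηθ : η * θ ≤ 1 / 1000) : η * hadamardRate z ≤ 1 / 250 :=
  calc η * hadamardRate z ≤ η * (4 * θ) := by gcongr; exact h.rate_le hαθ
    _ ≤ 1 / 250 := by linarith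

lemma abs_mul_gradient_le (h : StrongState α θ G z) (hη : 0 ≤ η) (hηθ : η * θ ≤ 1 / 1000)
    (he : |e| ≤ θ) : |η * (hadamardValue z - θ + e)| ≤ 1 / 500 :=
  calc |η * (hadamardValue z - θ + e)| ≤ η * (θ + θ) := by
        rw [abs_mul, abs_of_nonneg hη]
        gcongr
        exact (abs_add_le _ _).trans (add_le_add h.abs_value_sub_le he)
    _ ≤ 1 / 500 := by linarith

lemma step (h : StrongState α θ G z) (hm : 0 ≤ m) (hmθ : m ≤ θ) (hαθ : α ^ 2 ≤ θ) (hη : 0 ≤ η)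
    (hηθ : η * θ ≤ 1 / 1000) (he : |e| ≤ m / 16) :
    StrongState α θ (G * (1 + η * m / 4)) (hadamardStep η (hadamardValue z - θ + e) z) := by
  have := abs_nonneg e
  have hrate := h.mul_rate_le hη hαθ hηθ
  have hgrad := h.abs_mul_gradient_le hη hηθ (by linarith)
  have contract {D : ℝ} (hD : |hadamardValue z - θ| ≤ D) (hθD : θ / 2 ≤ D) :=
    abs_hadamardValue_step_sub_le_of_le hη (by linarith) hgrad hD (by linarith)
  have hv := hadamardValue_step η (hadamardValue z - θ + e) z
  set r := hadamardValue z - θ + e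
  have hmul : (hadamardStep η r z).1 * (hadamardStep η r z).2 ≤ α ^ 2 :=
    (hadamardStep_mul_le η r (mul_pos h.fst_pos h.snd_pos).le).trans h.mul_le
  obtain ⟨hr1, hr2⟩ := abs_le.1 hgrad
  have hpos1 : 0 < z.1 * (1 - η * r) := mul_pos h.fst_pos (by linarith)
  have hpos2 : 0 < z.2 * (1 + η * r) := mul_pos h.snd_pos (by linarith)
  have hnonneg := (abs_le.1 (contract h.abs_value_sub_le (by linarith))).1
  rcases le_or_gt (θ / 2) (hadamardValue z) with half_le | lt_half
  · obtain ⟨hlo, hhi⟩ := abs_le.1 <|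
      contract (abs_le.2 ⟨by linarith, by linarith [h.value_le]⟩) le_rfl
    exact ⟨hpos1, hpos2, hmul, by linarith, by linarith, Or.inl (by linarith)⟩
  · have hr_le : r ≤ -(m / 4) := by linarith [(abs_le.1 he).2]
    have hgrow : G * (1 + η * m / 4) ≤ z.1 * (1 - η * r) := by
      have hfactor : 1 + η * m / 4 ≤ 1 - η * r := by nlinarith
      have hG := h.half_le_or.resolve_left lt_half.not_ge
      exact (mul_le_mul_of_nonneg_right hG (by positivity)).trans
        (mul_le_mul_of_nonneg_left hfactor h.fst_pos.le)
    have hvalue_le : hadamardValue (hadamardStep η r z) ≤ 3 / 2 * θ := by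
      have hdrift : -(η * r) * hadamardRate z ≤ 1 / 500 * (4 * θ) :=
        mul_le_mul (by linarith) (h.rate_le hαθ) (hadamardRate_nonneg z) (by norm_num)
      have hquad : hadamardValue z * (η * r) ^ 2 ≤ hadamardValue z * 1 := by
        have := h.value_nonneg
        gcongr
        exact (sq_le_one_iff_abs_le_one _).2 (by linarith)
      linarith
    exact ⟨hpos1, hpos2, hmul, by linarith, hvalue_le, Or.inr hgrow⟩

end StrongState

/-- The state of a pair of factors whose product is driven to `0`: both lie in `(0, A]`. -/
structure NullState (A : ℝ) (z : ℝ × ℝ) : Prop where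
  fst_pos : 0 < z.1
  snd_pos : 0 < z.2
  fst_le : z.1 ≤ A
  snd_le : z.2 ≤ A

namespace NullState

lemma swap (h : NullState A z) : NullState A z.swap := ⟨h.snd_pos, h.fst_pos, h.snd_le, h.fst_le⟩

lemma abs_value_le (h : NullState A z) : |hadamardValue z| ≤ A ^ 2 / 4 := by
  have h1 : z.1 ^ 2 ≤ A ^ 2 := pow_le_pow_left₀ h.fst_pos.le h.fst_le 2
  have h2 : z.2 ^ 2 ≤ A ^ 2 := pow_le_pow_left₀ h.snd_pos.le h.snd_le 2
  rw [abs_le, hadamardValue]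
  constructor <;> linarith [sq_nonneg z.1, sq_nonneg z.2]

lemma abs_value_le_two_mul_sq (h : NullState A z) (hA : A ≤ α * 2.72) :
    |hadamardValue z| ≤ 2 * α ^ 2 := by
  have hA0 : 0 < A := h.fst_pos.trans_le h.fst_le
  calc |hadamardValue z| ≤ A ^ 2 / 4 := h.abs_value_le
    _ ≤ (α * 2.72) ^ 2 / 4 := by gcongr
    _ ≤ 2 * α ^ 2 := by linarith [sq_nonneg α, mul_pow α 2.72 2]

lemma fst_step_pos (h : NullState A z) (hA : A ≤ 1) (hη : 0 ≤ η) (hη' : η ≤ 1 / 2)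
    (he : η * |e| < 1 / 2) : 0 < (hadamardStep η (hadamardValue z + e) z).1 := by
  have hA0 : 0 < A := h.fst_pos.trans_le h.fst_le
  have hv : η * hadamardValue z ≤ 1 / 2 * (1 ^ 2 / 4) :=
    calc η * hadamardValue z ≤ η * (A ^ 2 / 4) := by
          gcongr; exact (le_abs_self _).trans h.abs_value_le
      _ ≤ 1 / 2 * (1 ^ 2 / 4) := by gcongr
  have he' : η * e ≤ η * |e| := by gcongr; exact le_abs_self e
  exact mul_pos h.fst_pos (by linarith)

/-- The quadratic part of the step is harmless: it lowers the larger factor and, as `η` is small,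
does not raise the smaller factor above the larger one. -/
lemma fst_step_le (h : NullState A z) (hA : A ≤ 1) (hη : 0 ≤ η) (hη' : η ≤ 1 / 2)
    (he : |e| ≤ E) : (hadamardStep η (hadamardValue z + e) z).1 ≤ A * (1 + η * E) := by
  have := h.fst_pos
  have := h.snd_pos
  have unperturbed : z.1 * (1 - η * hadamardValue z) ≤ A := by
    have factored : z.1 * (1 - η * hadamardValue z) =
        z.1 + η * (z.1 * (z.1 + z.2)) / 4 * (z.2 - z.1) := by rw [hadamardValue]; ring
    have hcoef : η * (z.1 * (z.1 + z.2)) ≤ 1 / 2 * (1 * (1 + 1)) := by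
      gcongr <;> linarith [h.fst_le, h.snd_le]
    have hcoef0 : 0 ≤ η * (z.1 * (z.1 + z.2)) := by positivity
    rcases le_total z.2 z.1 with hle | hle <;> nlinarith [h.fst_le, h.snd_le]
  have perturbation : z.1 * (η * -e) ≤ A * (η * E) := by
    have : 0 < A := h.fst_pos.trans_le h.fst_le
    have hE0 : 0 ≤ E := (abs_nonneg e).trans he
    calc z.1 * (η * -e) ≤ z.1 * (η * E) := by
          gcongr; exact (neg_le_abs e).trans he
      _ ≤ A * (η * E) := by gcongr; exact h.fst_le
  calc z.1 * (1 - η * (hadamardValue z + e))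
      = z.1 * (1 - η * hadamardValue z) + z.1 * (η * -e) := by ring
    _ ≤ A * (1 + η * E) := by linarith

lemma step (h : NullState A z) (hA : A ≤ 1) (hη : 0 ≤ η) (hη' : η ≤ 1 / 2) (he : |e| ≤ E)
    (hE : η * E < 1 / 2) :
    NullState (A * (1 + η * E)) (hadamardStep η (hadamardValue z + e) z) := by
  have hsmall : η * |e| < 1 / 2 := (mul_le_mul_of_nonneg_left he hη).trans_lt hE
  have hswap : (hadamardStep η (hadamardValue z + e) z).2 =
      (hadamardStep η (hadamardValue z.swap + -e) z.swap).1 := by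
    rw [hadamardValue_swap, ← neg_add, ← hadamardStep_swap, Prod.fst_swap]
  rw [← abs_neg] at he
  refine ⟨h.fst_step_pos hA hη hη' hsmall, ?_, h.fst_step_le hA hη hη' (by rwa [abs_neg] at he), ?_⟩
  · exact hswap ▸ h.swap.fst_step_pos hA hη hη' (by rwa [abs_neg])
  · exact hswap ▸ h.swap.fst_step_le hA hη hη' he

end NullState

/-- The pair `z` with its leading factor first when the product is driven to `θ`: a negative target
is exchanged for a positive one by swapping the factors `g + l` and `g - l`. -/
noncomputable def orient (θ : ℝ) (z : ℝ × ℝ) : ℝ × ℝ := if 0 < θ then z else z.swap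

lemma abs_hadamardValue_orient_sub (θ : ℝ) (z : ℝ × ℝ) :
    |(hadamardValue (orient θ z) - |θ|)| = |hadamardValue z - θ| := by
  rw [orient]
  split_ifs with hθ
  · rw [abs_of_pos hθ]
  · rw [hadamardValue_swap, abs_of_nonpos (not_lt.1 hθ), ← neg_sub', abs_neg]

lemma exists_orient_hadamardStep_eq (η θ e : ℝ) (z : ℝ × ℝ) : ∃ e' : ℝ, |e'| = |e| ∧
    orient θ (hadamardStep η (hadamardValue z - θ + e) z) =
      hadamardStep η (hadamardValue (orient θ z) - |θ| + e') (orient θ z) := by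
  simp only [orient]
  split_ifs with hθ
  · exact ⟨e, rfl, by rw [abs_of_pos hθ]⟩
  · refine ⟨-e, abs_neg e, ?_⟩
    rw [hadamardStep_swap, hadamardValue_swap, abs_of_nonpos (not_lt.1 hθ)]
    congr 1
    ring

end CoordinateDynamics

section ErrorEnvelope

variable {η m K T ε x D e : ℝ} {T₁ u : ℕ}

/-- The envelope of the error on the coordinates with nonzero target: constant up to time `T₁` (the
subtraction of natural numbers truncates), then geometrically decreasing to the level `4 * T`. -/
noncomputable def errEnvelope (η m K T : ℝ) (T₁ u : ℕ) : ℝ :=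
  K * (1 - η * m / 2) ^ (u - T₁) + 4 * T

lemma errEnvelope_of_le (hu : u ≤ T₁) : errEnvelope η m K T T₁ u = K + 4 * T := by
  rw [errEnvelope, Nat.sub_eq_zero_of_le hu, pow_zero, mul_one]

lemma errEnvelope_nonneg (hK : 0 ≤ K) (hT : 0 ≤ T) (hηm : η * m ≤ 1) (T₁ u : ℕ) :
    0 ≤ errEnvelope η m K T T₁ u := by
  have : 0 ≤ 1 - η * m / 2 := by linarith
  unfold errEnvelope
  positivity

lemma errEnvelope_le (hK : 0 ≤ K) (hηm0 : 0 ≤ η * m) (hηm : η * m ≤ 1) (T₁ u : ℕ) :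
    errEnvelope η m K T T₁ u ≤ K + 4 * T := by
  rw [errEnvelope]
  gcongr
  exact mul_le_of_le_one_right hK (pow_le_one₀ (by linarith) (by linarith))

lemma contraction_le_errEnvelope_succ (hu : T₁ ≤ u) (hηm : η * m ≤ x) (hηm0 : 0 ≤ η * m)
    (hx : x ≤ 1) (hε : ε ≤ 1 / 1000) (hK : 0 ≤ K) (hT : 0 ≤ T)
    (hD : D ≤ errEnvelope η m K T T₁ u) (he : e ≤ ε * errEnvelope η m K T T₁ u + T) :
    (1 - 9 / 10 * x) * D + 11 / 10 * x * e ≤ errEnvelope η m K T T₁ (u + 1) := by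
  have hx0 : 0 ≤ x := hηm0.trans hηm
  have hF0 := errEnvelope_nonneg hK hT (hηm.trans hx) T₁ u
  have hsucc : errEnvelope η m K T T₁ (u + 1) =
      K * (1 - η * m / 2) ^ (u - T₁) * (1 - η * m / 2) + 4 * T := by
    rw [errEnvelope, Nat.succ_sub hu, pow_succ, mul_assoc]
  have hY0 : 0 ≤ K * (1 - η * m / 2) ^ (u - T₁) :=
    mul_nonneg hK (pow_nonneg (by linarith) _)
  calc (1 - 9 / 10 * x) * D + 11 / 10 * x * e
      ≤ (1 - 9 / 10 * x) * errEnvelope η m K T T₁ u +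
          11 / 10 * x * (1 / 1000 * errEnvelope η m K T T₁ u + T) := by
        gcongr
        · linarith
        · exact he.trans (by gcongr)
    _ ≤ errEnvelope η m K T T₁ (u + 1) := by
        rw [hsucc, errEnvelope]
        nlinarith [mul_le_mul_of_nonneg_right hηm hY0, mul_nonneg hx0 hY0, mul_nonneg hx0 hT]

lemma sum_range_pow_sub_le (hx0 : 0 ≤ x) (hx1 : x < 1) (T₁ t : ℕ) :
    ∑ u ∈ Finset.range t, x ^ (u - T₁) ≤ T₁ + (1 - x)⁻¹ :=
  calc ∑ u ∈ Finset.range t, x ^ (u - T₁)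
      ≤ ∑ u ∈ Finset.range (T₁ + t), x ^ (u - T₁) :=
        Finset.sum_le_sum_of_subset_of_nonneg (Finset.range_mono (Nat.le_add_left t T₁))
          fun _ _ _ => by positivity
    _ = ∑ u ∈ Finset.range T₁, x ^ (u - T₁) + ∑ k ∈ Finset.range t, x ^ k := by
        simp only [Finset.sum_range_add, Nat.add_sub_cancel_left]
    _ ≤ ∑ _u ∈ Finset.range T₁, 1 + (1 - x)⁻¹ := by
        gcongr
        · exact pow_le_one₀ hx0 hx1.le
        · exact sum_le_hasSum _ (fun _ _ => by positivity) (hasSum_geometric_of_lt_one hx0 hx1)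
    _ = T₁ + (1 - x)⁻¹ := by simp

lemma sum_errEnvelope_le (hK : 0 ≤ K) (hηm0 : 0 < η * m) (hηm : η * m ≤ 1) (T₁ t : ℕ) :
    ∑ u ∈ Finset.range t, errEnvelope η m K T T₁ u ≤
      K * (T₁ + 2 / (η * m)) + t * (4 * T) := by
  have hgeom := sum_range_pow_sub_le (x := 1 - η * m / 2) (by linarith) (by linarith) T₁ t
  rw [sub_sub_cancel, inv_div] at hgeom
  simp only [errEnvelope, Finset.sum_add_distrib, ← Finset.mul_sum, Finset.sum_const,
    Finset.card_range, nsmul_eq_mul]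
  linarith [mul_le_mul_of_nonneg_left hgeom hK]

end ErrorEnvelope

/-- A parameter regime in which gradient descent separates the coordinates with nonzero target from
the others: initialization `α`, step size `η`, targets of absolute value in `[m, K]` and gradient
perturbations at most `ε * D + T`, where `D` bounds the error on the nonzero targets. -/
structure DescentRegime (α η m K ε T : ℝ) : Prop where
  init_pos : 0 < α
  init_le : α ≤ 1 / 3
  init_sq_le : α ^ 2 ≤ m
  min_pos : 0 < m
  min_le : m ≤ K
  step_pos : 0 < η
  step_le : η ≤ 1 / 2
  step_mul_le : η * K ≤ 1 / 1000
  slope_nonneg : 0 ≤ ε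
  slope_le : ε ≤ 1 / 1000
  slope_mul_le : ε * K ≤ m / 64
  noise_nonneg : 0 ≤ T
  noise_le : T ≤ m / 64

/-- The bound `ε * F + T` on the perturbation of the gradient at time `u`, where `F` is the error
envelope. -/
noncomputable def gradErrBound (η m K ε T : ℝ) (T₁ u : ℕ) : ℝ :=
  ε * errEnvelope η m K T T₁ u + T

/-- The level which the leading factor of a coordinate with nonzero target has reached at time `u`,
unless the product is already half of the target. -/
noncomputable def strongLevel (α η m : ℝ) (u : ℕ) : ℝ := α * (1 + η * m / 4) ^ u

/-- The level which the factors of a coordinate with target `0` do not exceed up to time `u`. -/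
noncomputable def nullLevel (α η m K ε T : ℝ) (T₁ u : ℕ) : ℝ :=
  α * Real.exp (η * ∑ v ∈ Finset.range u, gradErrBound η m K ε T T₁ v)

namespace DescentRegime

variable {α η m K ε T θ e : ℝ} {T₁ t u : ℕ} {z : ℝ × ℝ}

lemma max_pos (h : DescentRegime α η m K ε T) : 0 < K := h.min_pos.trans_le h.min_le

lemma step_mul_min_pos (h : DescentRegime α η m K ε T) : 0 < η * m := mul_pos h.step_pos h.min_pos

lemma step_mul_min_le (h : DescentRegime α η m K ε T) : η * m ≤ 1 / 1000 :=
  (mul_le_mul_of_nonneg_left h.min_le h.step_pos.le).trans h.step_mul_le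

lemma errEnvelope_nonneg (h : DescentRegime α η m K ε T) (T₁ u : ℕ) :
    0 ≤ errEnvelope η m K T T₁ u :=
  _root_.errEnvelope_nonneg h.max_pos.le h.noise_nonneg (by linarith [h.step_mul_min_le]) T₁ u

lemma gradErrBound_nonneg (h : DescentRegime α η m K ε T) (T₁ u : ℕ) :
    0 ≤ gradErrBound η m K ε T T₁ u :=
  add_nonneg (mul_nonneg h.slope_nonneg (h.errEnvelope_nonneg T₁ u)) h.noise_nonneg

lemma gradErrBound_le (h : DescentRegime α η m K ε T) (T₁ u : ℕ) :
    gradErrBound η m K ε T T₁ u ≤ m / 16 :=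
  calc gradErrBound η m K ε T T₁ u ≤ ε * (K + 4 * T) + T := by
        have := h.slope_nonneg
        have := errEnvelope_le (T := T) h.max_pos.le h.step_mul_min_pos.le
          (by linarith [h.step_mul_min_le]) T₁ u
        unfold gradErrBound
        gcongr
    _ = ε * K + ε * (4 * T) + T := by ring
    _ ≤ m / 16 := by
        have := mul_le_mul_of_nonneg_right h.slope_le (by linarith [h.noise_nonneg] : 0 ≤ 4 * T)
        linarith [h.slope_mul_le, h.noise_le, h.min_pos]

lemma strongLevel_nonneg (h : DescentRegime α η m K ε T) (u : ℕ) : 0 ≤ strongLevel α η m u :=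
  mul_nonneg h.init_pos.le (pow_nonneg (by linarith [h.step_mul_min_pos]) _)

lemma strongLevel_sq_mono (h : DescentRegime α η m K ε T) (hu : T₁ ≤ u) :
    strongLevel α η m T₁ ^ 2 ≤ strongLevel α η m u ^ 2 := by
  have := h.strongLevel_nonneg T₁
  have := h.init_pos
  have : 1 ≤ 1 + η * m / 4 := by linarith [h.step_mul_min_pos]
  unfold strongLevel at *
  gcongr

lemma half_le_hadamardValue (h : DescentRegime α η m K ε T)
    (hz : StrongState α θ (strongLevel α η m u) z) (hθK : θ ≤ K)
    (hT₁ : 2 * K + α ^ 2 ≤ strongLevel α η m T₁ ^ 2) (hu : T₁ ≤ u) : θ / 2 ≤ hadamardValue z :=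
  hz.half_le (h.strongLevel_nonneg u) (by linarith [h.strongLevel_sq_mono hu])

lemma strongState_step (h : DescentRegime α η m K ε T)
    (hz : StrongState α θ (strongLevel α η m u) z) (hmθ : m ≤ θ) (hθK : θ ≤ K)
    (he : |e| ≤ gradErrBound η m K ε T T₁ u) :
    StrongState α θ (strongLevel α η m (u + 1))
      (hadamardStep η (hadamardValue z - θ + e) z) := by
  have hηθ : η * θ ≤ 1 / 1000 :=
    (mul_le_mul_of_nonneg_left hθK h.step_pos.le).trans h.step_mul_le
  rw [strongLevel, pow_succ, ← mul_assoc]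
  exact hz.step h.min_pos.le hmθ (h.init_sq_le.trans hmθ) h.step_pos.le hηθ
    (he.trans (h.gradErrBound_le T₁ u))

/-- Up to time `T₁` only `|value - θ| ≤ θ` is used; after it the value is at least `θ / 2`, which
gives the error a contraction rate proportional to `m`. -/
lemma abs_hadamardValue_step_sub_le_errEnvelope (h : DescentRegime α η m K ε T)
    (hz : StrongState α θ (strongLevel α η m u) z) (hmθ : m ≤ θ) (hθK : θ ≤ K)
    (hT₁ : 2 * K + α ^ 2 ≤ strongLevel α η m T₁ ^ 2)
    (hF : |hadamardValue z - θ| ≤ errEnvelope η m K T T₁ u)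
    (he : |e| ≤ gradErrBound η m K ε T T₁ u) :
    |hadamardValue (hadamardStep η (hadamardValue z - θ + e) z) - θ| ≤
      errEnvelope η m K T T₁ (u + 1) := by
  rcases lt_or_ge u T₁ with hu | hu
  · rw [errEnvelope_of_le hu]
    linarith [(h.strongState_step hz hmθ hθK he).abs_value_sub_le, h.noise_nonneg]
  · have hηθ : η * θ ≤ 1 / 1000 :=
      (mul_le_mul_of_nonneg_left hθK h.step_pos.le).trans h.step_mul_le
    have hrate_le := hz.mul_rate_le h.step_pos.le (h.init_sq_le.trans hmθ) hηθ
    have hm_le_rate : m ≤ hadamardRate z := by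
      linarith [h.half_le_hadamardValue hz hθK hT₁ hu, le_abs_self (hadamardValue z),
        abs_hadamardValue_le z]
    have heθ : |e| ≤ θ := by linarith [h.gradErrBound_le T₁ u, h.min_pos]
    refine (abs_hadamardValue_step_sub_le h.step_pos.le (by linarith)
      (hz.abs_mul_gradient_le h.step_pos.le hηθ heθ)).trans ?_
    exact contraction_le_errEnvelope_succ hu
      (mul_le_mul_of_nonneg_left hm_le_rate h.step_pos.le) h.step_mul_min_pos.le (by linarith)
      h.slope_le h.max_pos.le h.noise_nonneg hF he

lemma nullLevel_le (h : DescentRegime α η m K ε T)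
    (hsum : η * ∑ v ∈ Finset.range t, gradErrBound η m K ε T T₁ v ≤ 1) (hu : u ≤ t) :
    nullLevel α η m K ε T T₁ u ≤ α * 2.72 := by
  have hsum_le : ∑ v ∈ Finset.range u, gradErrBound η m K ε T T₁ v ≤
      ∑ v ∈ Finset.range t, gradErrBound η m K ε T T₁ v :=
    Finset.sum_le_sum_of_subset_of_nonneg (Finset.range_mono hu)
      fun v _ _ => h.gradErrBound_nonneg T₁ v
  have hexp := Real.exp_le_exp.2 ((mul_le_mul_of_nonneg_left hsum_le h.step_pos.le).trans hsum)
  exact mul_le_mul_of_nonneg_left (by linarith [Real.exp_one_lt_d9]) h.init_pos.le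

lemma nullLevel_mul_le (h : DescentRegime α η m K ε T) (T₁ u : ℕ) :
    nullLevel α η m K ε T T₁ u * (1 + η * gradErrBound η m K ε T T₁ u) ≤
      nullLevel α η m K ε T T₁ (u + 1) := by
  have := h.init_pos
  rw [nullLevel, nullLevel, Finset.sum_range_succ, mul_add η, Real.exp_add, ← mul_assoc, add_comm 1]
  gcongr
  exact Real.add_one_le_exp _

lemma nullState_step (h : DescentRegime α η m K ε T)
    (hz : NullState (nullLevel α η m K ε T T₁ u) z)
    (hlevel : nullLevel α η m K ε T T₁ u ≤ α * 2.72)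
    (he : |e| ≤ gradErrBound η m K ε T T₁ u) :
    NullState (nullLevel α η m K ε T T₁ (u + 1)) (hadamardStep η (hadamardValue z + e) z) := by
  have hE : η * gradErrBound η m K ε T T₁ u ≤ η * (m / 16) :=
    mul_le_mul_of_nonneg_left (h.gradErrBound_le T₁ u) h.step_pos.le
  have hstep := hz.step (by linarith [h.init_le]) h.step_pos.le h.step_le he
    (by linarith [h.step_mul_min_le])
  have hle := h.nullLevel_mul_le T₁ u
  exact ⟨hstep.fst_pos, hstep.snd_pos, hstep.fst_le.trans hle, hstep.snd_le.trans hle⟩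

lemma mul_sum_gradErrBound_le (h : DescentRegime α η m K ε T) (T₁ t : ℕ) :
    η * ∑ v ∈ Finset.range t, gradErrBound η m K ε T T₁ v ≤
      ε * (K / m) * (η * m * T₁ + 2) + (4 * ε + 1) * (t * (η * T)) := by
  have := h.step_pos
  have := h.min_pos
  have := h.slope_nonneg
  have henv := sum_errEnvelope_le (T := T) h.max_pos.le h.step_mul_min_pos
    (by linarith [h.step_mul_min_le]) T₁ t
  calc η * ∑ v ∈ Finset.range t, gradErrBound η m K ε T T₁ v
      = η * (ε * ∑ v ∈ Finset.range t, errEnvelope η m K T T₁ v + t * T) := by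
        simp only [gradErrBound, Finset.sum_add_distrib, Finset.mul_sum, Finset.sum_const,
          Finset.card_range, nsmul_eq_mul]
    _ ≤ η * (ε * (K * (T₁ + 2 / (η * m)) + t * (4 * T)) + t * T) := by gcongr
    _ = ε * (K / m) * (η * m * T₁ + 2) + (4 * ε + 1) * (t * (η * T)) := by
        field_simp
        ring

end DescentRegime

lemma exp_half_le_one_add {x : ℝ} (hx0 : 0 ≤ x) (hx1 : x ≤ 1) : Real.exp (x / 2) ≤ 1 + x := by
  have hexp_neg := Real.add_one_le_exp (-(x / 2))
  rw [Real.exp_neg, ← one_div, le_div_iff₀ (Real.exp_pos _)] at hexp_neg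
  nlinarith [Real.exp_pos (x / 2), mul_nonneg hx0 (sub_nonneg.2 hx1)]

lemma sq_div_le_strongLevel {q α η m : ℝ} {T₁ : ℕ} (hα : 0 < α) (hq : 0 < q) (hηm : 0 < η * m)
    (hηm1 : η * m ≤ 1) (hT₁ : 16 * Real.log (q / α) / (η * m) ≤ T₁) :
    q ^ 2 / α ≤ strongLevel α η m T₁ := by
  rw [div_le_iff₀ hηm] at hT₁
  have hgrowth : (q / α) ^ 2 ≤ (1 + η * m / 4) ^ T₁ := by
    calc (q / α) ^ 2 = Real.exp (2 * Real.log (q / α)) := by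
          rw [two_mul, Real.exp_add, Real.exp_log (by positivity), sq]
      _ ≤ Real.exp (T₁ * (η * m / 4 / 2)) := Real.exp_le_exp.2 (by linarith)
      _ = Real.exp (η * m / 4 / 2) ^ T₁ := Real.exp_nat_mul _ _
      _ ≤ (1 + η * m / 4) ^ T₁ := by
          gcongr
          exact exp_half_le_one_add (by linarith) (by linarith)
  calc q ^ 2 / α = α * (q / α) ^ 2 := by field_simp
    _ ≤ strongLevel α η m T₁ := mul_le_mul_of_nonneg_left hgrowth hα.le

section VectorDynamics

variable {ι : Type*} {S : Set ι} {θ : ι → ℝ} {α η m K ε T : ℝ} {z : ℕ → ι → ℝ × ℝ}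
  {e : ℕ → ι → ℝ} {T₁ t u : ℕ}

/-- Gradient descent on factor pairs `z u j` with targets `θ j`, nonzero on `S` only, where `e u j`
is the perturbation of the ideal gradient `hadamardValue (z u j) - θ j`. The perturbation of every
coordinate is bounded by the error `D` on `S`, as long as the coordinates off `S` stay small. -/
structure PerturbedDescent (S : Set ι) (θ : ι → ℝ) (α η m K ε T : ℝ) (z : ℕ → ι → ℝ × ℝ)
    (e : ℕ → ι → ℝ) : Prop where
  zero : ∀ j, z 0 j = (α, α)
  succ : ∀ u j, z (u + 1) j = hadamardStep η (hadamardValue (z u j) - θ j + e u j) (z u j)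
  target_eq_zero : ∀ j ∉ S, θ j = 0
  le_target : ∀ j ∈ S, m ≤ |θ j|
  target_le : ∀ j ∈ S, |θ j| ≤ K
  err_le : ∀ u D, 0 ≤ D → (∀ j ∈ S, |hadamardValue (z u j) - θ j| ≤ D) →
    (∀ j ∉ S, |hadamardValue (z u j)| ≤ 2 * α ^ 2) → ∀ j, |e u j| ≤ ε * D + T

/-- The invariant of perturbed gradient descent at time `u`. -/
structure DescentInvariant (S : Set ι) (θ : ι → ℝ) (α η m K ε T : ℝ) (T₁ u : ℕ)
    (z : ι → ℝ × ℝ) : Prop where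
  strong : ∀ j ∈ S, StrongState α |θ j| (strongLevel α η m u) (orient (θ j) (z j))
  abs_sub_le : ∀ j ∈ S, |hadamardValue (z j) - θ j| ≤ errEnvelope η m K T T₁ u
  null : ∀ j ∉ S, NullState (nullLevel α η m K ε T T₁ u) (z j)

namespace PerturbedDescent

lemma invariant_zero (hz : PerturbedDescent S θ α η m K ε T z e)
    (h : DescentRegime α η m K ε T) (T₁ : ℕ) : DescentInvariant S θ α η m K ε T T₁ 0 (z 0) where
  strong j _ := by
    have : orient (θ j) (α, α) = (α, α) := by simp [orient]
    rw [hz.zero, this, strongLevel, pow_zero, mul_one]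
    exact .init h.init_pos (abs_nonneg _)
  abs_sub_le j hj := by
    rw [hz.zero, errEnvelope_of_le (Nat.zero_le _)]
    simp only [hadamardValue, sub_self, zero_div, zero_sub, abs_neg]
    linarith [hz.target_le j hj, h.noise_nonneg]
  null j _ := by
    have : nullLevel α η m K ε T T₁ 0 = α := by simp [nullLevel]
    rw [hz.zero, this]
    exact ⟨h.init_pos, h.init_pos, le_rfl, le_rfl⟩

lemma invariant_succ (hz : PerturbedDescent S θ α η m K ε T z e)
    (h : DescentRegime α η m K ε T) (hT₁ : 2 * K + α ^ 2 ≤ strongLevel α η m T₁ ^ 2)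
    (hlevel : nullLevel α η m K ε T T₁ u ≤ α * 2.72)
    (inv : DescentInvariant S θ α η m K ε T T₁ u (z u)) :
    DescentInvariant S θ α η m K ε T T₁ (u + 1) (z (u + 1)) := by
  have herr : ∀ j, |e u j| ≤ gradErrBound η m K ε T T₁ u :=
    hz.err_le u _ (h.errEnvelope_nonneg T₁ u) inv.abs_sub_le
      fun j hj => (inv.null j hj).abs_value_le_two_mul_sq hlevel
  refine ⟨fun j hj => ?_, fun j hj => ?_, fun j hj => ?_⟩
  · obtain ⟨e', he', hstep⟩ := exists_orient_hadamardStep_eq η (θ j) (e u j) (z u j)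
    rw [hz.succ, hstep]
    exact h.strongState_step (inv.strong j hj) (hz.le_target j hj) (hz.target_le j hj)
      (he' ▸ herr j)
  · obtain ⟨e', he', hstep⟩ := exists_orient_hadamardStep_eq η (θ j) (e u j) (z u j)
    rw [hz.succ, ← abs_hadamardValue_orient_sub, hstep]
    refine h.abs_hadamardValue_step_sub_le_errEnvelope (inv.strong j hj) (hz.le_target j hj)
      (hz.target_le j hj) hT₁ ?_ (he' ▸ herr j)
    rw [abs_hadamardValue_orient_sub]
    exact inv.abs_sub_le j hj
  · rw [hz.succ, hz.target_eq_zero j hj, sub_zero]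
    exact h.nullState_step (inv.null j hj) hlevel (herr j)

lemma invariant (hz : PerturbedDescent S θ α η m K ε T z e) (h : DescentRegime α η m K ε T)
    (hT₁ : 2 * K + α ^ 2 ≤ strongLevel α η m T₁ ^ 2)
    (hsum : η * ∑ v ∈ Finset.range t, gradErrBound η m K ε T T₁ v ≤ 1) (hu : u ≤ t) :
    DescentInvariant S θ α η m K ε T T₁ u (z u) := by
  induction u with
  | zero => exact hz.invariant_zero h T₁
  | succ u ih =>
    exact hz.invariant_succ h hT₁ (h.nullLevel_le hsum (by omega)) (ih (by omega))

theorem abs_hadamardValue_sub_le (hz : PerturbedDescent S θ α η m K ε T z e)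
    (h : DescentRegime α η m K ε T) (hT₁ : 2 * K + α ^ 2 ≤ strongLevel α η m T₁ ^ 2)
    (hT₁t : T₁ ≤ t) (hsum : η * ∑ v ∈ Finset.range t, gradErrBound η m K ε T T₁ v ≤ 1)
    {j : ι} (hj : j ∈ S) : |hadamardValue (z t j) - θ j| ≤ |θ j| / 2 := by
  have hstate := (hz.invariant h hT₁ hsum le_rfl).strong j hj
  have half_le := h.half_le_hadamardValue hstate (hz.target_le j hj) hT₁ hT₁t
  rw [← abs_hadamardValue_orient_sub, abs_le]
  constructor <;> linarith [hstate.value_le]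

theorem abs_hadamardValue_le (hz : PerturbedDescent S θ α η m K ε T z e)
    (h : DescentRegime α η m K ε T) (hT₁ : 2 * K + α ^ 2 ≤ strongLevel α η m T₁ ^ 2)
    (hsum : η * ∑ v ∈ Finset.range t, gradErrBound η m K ε T T₁ v ≤ 1)
    {j : ι} (hj : j ∉ S) : |hadamardValue (z t j)| ≤ 2 * α ^ 2 :=
  ((hz.invariant h hT₁ hsum le_rfl).null j hj).abs_value_le_two_mul_sq
    (h.nullLevel_le hsum le_rfl)

end PerturbedDescent

end VectorDynamics

section RestrictedIsometry

variable {n p k : ℕ} {X : Matrix (Fin n) (Fin p) ℝ} {δ : ℝ} {u v : Fin p → ℝ}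

lemma mem_vecSupport {j : Fin p} : j ∈ vecSupport u ↔ u j ≠ 0 := by simp [vecSupport]

lemma vecSupport_add_smul_subset (u v : Fin p → ℝ) (c : ℝ) :
    vecSupport (v + c • u) ⊆ vecSupport u ∪ vecSupport v := by
  intro j
  simp only [Finset.mem_union, mem_vecSupport, Pi.add_apply, Pi.smul_apply, smul_eq_mul]
  contrapose!
  rintro ⟨hu, hv⟩
  simp [hu, hv]

lemma vecSupport_single_one (j : Fin p) : vecSupport (Pi.single j 1 : Fin p → ℝ) = {j} := by
  ext i
  simp [mem_vecSupport, Pi.single_apply]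

lemma sum_single_one_sq (j : Fin p) : ∑ i, (Pi.single j 1 : Fin p → ℝ) i ^ 2 = 1 := by
  simp [Pi.single_apply]

lemma sqrt_sum_sq_le {S : Finset (Fin p)} {D : ℝ} (hu : vecSupport u ⊆ S) (hD : 0 ≤ D)
    (h : ∀ i, |u i| ≤ D) : √(∑ i, u i ^ 2) ≤ √S.card * D := by
  have hzero : ∀ i ∉ S, u i ^ 2 = 0 := fun i hi =>
    pow_eq_zero_iff two_ne_zero |>.2 (not_not.1 fun hne => hi (hu (mem_vecSupport.2 hne)))
  calc √(∑ i, u i ^ 2) = √(∑ i ∈ S, u i ^ 2) := by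
        rw [Finset.sum_subset S.subset_univ fun i _ hi => hzero i hi]
    _ ≤ √(∑ _i ∈ S, D ^ 2) := Real.sqrt_le_sqrt <|
        Finset.sum_le_sum fun i _ => sq_le_sq.2 ((h i).trans (le_abs_self D))
    _ = √S.card * D := by
        rw [Finset.sum_const, nsmul_eq_mul, Real.sqrt_mul (Nat.cast_nonneg _), Real.sqrt_sq hD]

/-- The deviation `n⁻¹ Xᵀ X - 1` of the normalized Gram matrix from the identity. -/
noncomputable def gramDefect (X : Matrix (Fin n) (Fin p) ℝ) : Matrix (Fin p) (Fin p) ℝ :=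
  (1 / (n : ℝ)) • (Xᵀ * X) - 1

lemma gramDefect_mulVec (X : Matrix (Fin n) (Fin p) ℝ) (u : Fin p → ℝ) :
    gramDefect X *ᵥ u = (1 / (n : ℝ)) • (Xᵀ *ᵥ (X *ᵥ u)) - u := by
  rw [gramDefect, Matrix.sub_mulVec, Matrix.smul_mulVec, Matrix.one_mulVec, Matrix.mulVec_mulVec]

lemma dotProduct_gramDefect_comm (X : Matrix (Fin n) (Fin p) ℝ) (u v : Fin p → ℝ) :
    u ⬝ᵥ gramDefect X *ᵥ v = v ⬝ᵥ gramDefect X *ᵥ u := by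
  have hsymm : (gramDefect X)ᵀ = gramDefect X := by
    simp [gramDefect, Matrix.transpose_smul, Matrix.transpose_sub]
  rw [← Matrix.dotProduct_transpose_mulVec, hsymm, dotProduct_comm]

lemma dotProduct_gramDefect_self (X : Matrix (Fin n) (Fin p) ℝ) (u : Fin p → ℝ) :
    u ⬝ᵥ gramDefect X *ᵥ u = 1 / (n : ℝ) * ∑ i, (X *ᵥ u) i ^ 2 - ∑ j, u j ^ 2 := by
  rw [gramDefect_mulVec, dotProduct_sub, dotProduct_smul, Matrix.dotProduct_transpose_mulVec]
  simp only [dotProduct, smul_eq_mul, sq]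

lemma dotProduct_gramDefect_polarization (X : Matrix (Fin n) (Fin p) ℝ) (u v : Fin p → ℝ)
    (c : ℝ) : (v + c • u) ⬝ᵥ gramDefect X *ᵥ (v + c • u) -
      (v + (-c) • u) ⬝ᵥ gramDefect X *ᵥ (v + (-c) • u) = 4 * c * (u ⬝ᵥ gramDefect X *ᵥ v) := by
  simp only [Matrix.mulVec_add, Matrix.mulVec_smul, dotProduct_add, add_dotProduct,
    dotProduct_smul, smul_dotProduct, smul_eq_mul, dotProduct_gramDefect_comm X v u]
  ring

lemma RIP.abs_dotProduct_gramDefect_self_le (hX : RIP X k δ) (hu : (vecSupport u).card ≤ k) :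
    |u ⬝ᵥ gramDefect X *ᵥ u| ≤ δ * ∑ j, u j ^ 2 := by
  obtain ⟨hlo, hhi⟩ := hX u hu
  rw [dotProduct_gramDefect_self, abs_le]
  constructor <;> linarith

/-- By polarization `v + c • u` and `v - c • u` give a quadratic polynomial in `c` without sign
change, and the bound is its discriminant inequality. -/
lemma RIP.abs_dotProduct_gramDefect_le (hX : RIP X k δ) (hδ : 0 ≤ δ)
    (huv : (vecSupport u ∪ vecSupport v).card ≤ k) :
    |u ⬝ᵥ gramDefect X *ᵥ v| ≤ δ * √(∑ j, u j ^ 2) * √(∑ j, v j ^ 2) := by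
  set b := u ⬝ᵥ gramDefect X *ᵥ v
  set U := ∑ j, u j ^ 2 with hU
  set V := ∑ j, v j ^ 2 with hV
  have hU0 : 0 ≤ U := Finset.sum_nonneg fun _ _ => sq_nonneg _
  have hV0 : 0 ≤ V := Finset.sum_nonneg fun _ _ => sq_nonneg _
  have hform (c : ℝ) := abs_le.1 <| hX.abs_dotProduct_gramDefect_self_le <|
    (Finset.card_le_card (vecSupport_add_smul_subset u v c)).trans huv
  have hparallelogram (c : ℝ) :
      ∑ j, (v + c • u) j ^ 2 + ∑ j, (v + (-c) • u) j ^ 2 = 2 * (V + c ^ 2 * U) := by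
    rw [hU, hV, Finset.mul_sum, ← Finset.sum_add_distrib, ← Finset.sum_add_distrib,
      Finset.mul_sum]
    refine Finset.sum_congr rfl fun j _ => ?_
    simp only [Pi.add_apply, Pi.smul_apply, smul_eq_mul]
    ring
  have hquadratic (c : ℝ) : 0 ≤ δ * U * (c * c) + -(2 * b) * c + δ * V := by
    have := dotProduct_gramDefect_polarization X u v c
    nlinarith [(hform c).2, (hform (-c)).1, hparallelogram c]
  have hdiscrim : b ^ 2 ≤ (δ * √U * √V) ^ 2 := by
    have := discrim_le_zero hquadratic
    rw [discrim] at this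
    rw [mul_pow, mul_pow, Real.sq_sqrt hU0, Real.sq_sqrt hV0]
    linarith
  exact abs_le_of_sq_le_sq hdiscrim (by positivity)

lemma RIP.nonneg (hX : RIP X k δ) (hk : 1 ≤ k) (j : Fin p) : 0 ≤ δ := by
  have hcard : (vecSupport (Pi.single j 1 : Fin p → ℝ)).card ≤ k := by
    rwa [vecSupport_single_one, Finset.card_singleton]
  have h := (abs_nonneg _).trans (hX.abs_dotProduct_gramDefect_self_le hcard)
  rwa [sum_single_one_sq, mul_one] at h

lemma RIP.column_le (hX : RIP X k δ) (hk : 1 ≤ k) (j : Fin p) :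
    1 / (n : ℝ) * ∑ i, X i j ^ 2 ≤ 1 + δ := by
  have hcard : (vecSupport (Pi.single j 1 : Fin p → ℝ)).card ≤ k := by
    rwa [vecSupport_single_one, Finset.card_singleton]
  have h := (hX _ hcard).2
  rwa [sum_single_one_sq, mul_one, Matrix.mulVec_single_one] at h

lemma RIP.abs_gramDefect_mulVec_le (hX : RIP X k δ) (hu : (vecSupport u).card + 1 ≤ k)
    (j : Fin p) : |(gramDefect X *ᵥ u) j| ≤ δ * √(∑ i, u i ^ 2) := by
  have hcard : (vecSupport (Pi.single j 1 : Fin p → ℝ) ∪ vecSupport u).card ≤ k := by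
    rw [vecSupport_single_one]
    refine (Finset.card_union_le _ _).trans ?_
    rwa [Finset.card_singleton, add_comm]
  have h := hX.abs_dotProduct_gramDefect_le (hX.nonneg (le_of_add_le_right hu) j) hcard
  rwa [single_one_dotProduct, sum_single_one_sq, Real.sqrt_one, mul_one] at h

lemma RIP.abs_gramDefect_mulVec_le_of_subset (hX : RIP X k δ) {S : Finset (Fin p)}
    (hS : S.card + 1 ≤ k) (hu : vecSupport u ⊆ S) {D : ℝ} (hD : ∀ i, |u i| ≤ D) (j : Fin p) :
    |(gramDefect X *ᵥ u) j| ≤ δ * (√S.card * D) := by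
  have hcard := Finset.card_le_card hu
  refine (hX.abs_gramDefect_mulVec_le (by omega) j).trans ?_
  have hδ := hX.nonneg (by omega) j
  gcongr
  exact sqrt_sum_sq_le hu ((abs_nonneg _).trans (hD j)) hD

lemma RIP.abs_gramDefect_mulVec_le_of_forall (hX : RIP X k δ) (hk : 2 ≤ k) {M : ℝ}
    (hM : ∀ i, |u i| ≤ M) (j : Fin p) : |(gramDefect X *ᵥ u) j| ≤ δ * (p * M) := by
  have hentry (i : Fin p) : |gramDefect X j i| ≤ δ := by
    have hcard : (vecSupport (Pi.single i 1 : Fin p → ℝ)).card + 1 ≤ k := by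
      rwa [vecSupport_single_one, Finset.card_singleton]
    have h := hX.abs_gramDefect_mulVec_le hcard j
    rwa [sum_single_one_sq, Real.sqrt_one, mul_one, Matrix.mulVec_single_one] at h
  have hδ := hX.nonneg (by omega) j
  calc |(gramDefect X *ᵥ u) j| ≤ ∑ i, |gramDefect X j i * u i| := by
        rw [Matrix.mulVec, dotProduct]
        exact Finset.abs_sum_le_sum_abs _ _
    _ ≤ ∑ _i : Fin p, δ * M := by
        gcongr with i
        rw [abs_mul]
        gcongr
        exacts [hentry i, hM i]
    _ = δ * (p * M) := by
        rw [Finset.sum_const, Finset.card_univ, Fintype.card_fin, nsmul_eq_mul]; ring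

lemma residualGrad_eq (X : Matrix (Fin n) (Fin p) ℝ) (β g l : Fin p → ℝ) (w : Fin n → ℝ) :
    residualGrad X (X *ᵥ β + w) g l =
      (g * l - β) + gramDefect X *ᵥ (g * l - β) - (1 / (n : ℝ)) • (Xᵀ *ᵥ w) := by
  rw [residualGrad, gramDefect_mulVec, ← sub_sub, ← Matrix.mulVec_sub, Matrix.mulVec_sub Xᵀ,
    smul_sub, add_sub_cancel]

/-- The error `v - β` splits into a part supported on `S`, on which the isometry property acts with
the factor `√|S|`, and the part of `v` off `S₁`, whose entries are estimated one by one. -/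
lemma RIP.abs_residualGrad_sub_le {β g l : Fin p → ℝ} {w : Fin n → ℝ} {S₁ : Set (Fin p)}
    {D M W A : ℝ} (hX : RIP X ((vecSupport β).card + 1) δ) (hβ : 1 ≤ (vecSupport β).card)
    (hS₁ : S₁ ⊆ vecSupport β) (hW : ∀ i ∉ S₁, |β i| ≤ W) (hD : ∀ i ∈ S₁, |(g * l) i - β i| ≤ D)
    (hM : ∀ i ∉ S₁, |(g * l) i| ≤ M) (hD0 : 0 ≤ D) (hM0 : 0 ≤ M) (hW0 : 0 ≤ W) (j : Fin p)
    (hA : |((1 / (n : ℝ)) • (Xᵀ *ᵥ w)) j| ≤ A) :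
    |residualGrad X (X *ᵥ β + w) g l j - ((g * l) j - S₁.indicator β j)| ≤
      W + δ * (√(vecSupport β).card * (D + W)) + δ * (p * M) + A := by
  set v := g * l
  set ω := S₁ᶜ.indicator β with hω
  set h := S₁.indicator (v - β) - ω with hh
  have hsplit : v - β = h + S₁ᶜ.indicator v := by
    classical
    ext i
    by_cases hi : i ∈ S₁ <;> simp [hh, hω, hi, sub_eq_neg_add]
  have hωW (i : Fin p) : |ω i| ≤ W := by
    by_cases hi : i ∈ S₁ <;> simp [hω, hi, hW0, hW]
  have hsupp : vecSupport h ⊆ vecSupport β := by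
    intro i hi
    by_contra hβi
    have hi₁ : i ∉ S₁ := fun hmem => hβi (hS₁ hmem)
    exact mem_vecSupport.1 hi (by simpa [hh, hω, hi₁, mem_vecSupport] using hβi)
  have hhD (i : Fin p) : |h i| ≤ D + W := by
    refine (abs_sub _ _).trans (add_le_add ?_ (hωW i))
    by_cases hi : i ∈ S₁ <;> simp [hi, hD0, hD]
  have hvM (i : Fin p) : |S₁ᶜ.indicator v i| ≤ M := by
    by_cases hi : i ∈ S₁ <;> simp [hi, hM0, hM]
  have hsparse := hX.abs_gramDefect_mulVec_le_of_subset le_rfl hsupp hhD j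
  have hdense := hX.abs_gramDefect_mulVec_le_of_forall (by omega) hvM j
  have hdecomp : residualGrad X (X *ᵥ β + w) g l j - (v j - S₁.indicator β j) =
      -ω j + (gramDefect X *ᵥ h) j + (gramDefect X *ᵥ S₁ᶜ.indicator v) j -
        ((1 / (n : ℝ)) • (Xᵀ *ᵥ w)) j := by
    have hβj : β j = S₁.indicator β j + ω j :=
      congrFun (Set.indicator_self_add_compl S₁ β).symm j
    rw [residualGrad_eq, hsplit, Matrix.mulVec_add, ← hsplit]
    simp only [Pi.add_apply, Pi.sub_apply]
    linarith
  rw [hdecomp]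
  refine (abs_sub _ _).trans (add_le_add ((abs_add_three _ _ _).trans ?_) hA)
  rw [abs_neg]
  exact add_le_add (add_le_add (hωW j) hsparse) hdense

end RestrictedIsometry

section Noise

variable {Ω : Type*} [MeasurableSpace Ω] {P : Measure Ω}

lemma hasSubgaussianMGF_of_hasLaw_gaussianReal {Z : Ω → ℝ} {v : NNReal}
    (hZ : HasLaw Z (gaussianReal 0 v) P) : HasSubgaussianMGF Z v P where
  integrable_exp_mul t := by
    have := hZ.isProbabilityMeasure
    rw [← mgf_pos_iff, mgf_gaussianReal hZ.map_eq]
    positivity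
  mgf_le t := by
    rw [mgf_gaussianReal hZ.map_eq, zero_mul, zero_add]

lemma hasSubgaussianMGF_mono {Z : Ω → ℝ} {c d : NNReal} (hZ : HasSubgaussianMGF Z c P)
    (hcd : c ≤ d) : HasSubgaussianMGF Z d P where
  integrable_exp_mul := hZ.integrable_exp_mul
  mgf_le t := (hZ.mgf_le t).trans (by gcongr)

lemma hasSubgaussianMGF_sum_mul {ι : Type*} [Fintype ι] {Z : ι → Ω → ℝ} {c d : NNReal}
    (hind : iIndepFun Z P) (hZ : ∀ i, HasSubgaussianMGF (Z i) c P) {r : ι → ℝ}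
    (hr : (∑ i, r i ^ 2) * c ≤ d) : HasSubgaussianMGF (fun ω => ∑ i, r i * Z i ω) d P := by
  refine hasSubgaussianMGF_mono (HasSubgaussianMGF.sum_of_iIndepFun
    (hind.comp (fun i x => r i * x) fun i => measurable_const_mul (r i))
    fun i _ => (hZ i).const_mul (r i)) ?_
  rw [← NNReal.coe_le_coe, NNReal.coe_sum]
  exact (Finset.sum_mul _ _ _).symm.trans_le hr

lemma measureReal_lt_abs_le {Z : Ω → ℝ} {c : NNReal} {ε : ℝ} [IsFiniteMeasure P]
    (hZ : HasSubgaussianMGF Z c P) (hε : 0 ≤ ε) :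
    P.real {ω | ε < |Z ω|} ≤ 2 * Real.exp (-ε ^ 2 / (2 * c)) :=
  calc P.real {ω | ε < |Z ω|} ≤ P.real ({ω | ε ≤ Z ω} ∪ {ω | ε ≤ (-Z) ω}) :=
        measureReal_mono fun ω (hω : ε < |Z ω|) =>
          (lt_abs.1 hω).imp (fun h => h.le) (fun h : ε < -Z ω => h.le)
    _ ≤ P.real {ω | ε ≤ Z ω} + P.real {ω | ε ≤ (-Z) ω} := measureReal_union_le _ _
    _ ≤ 2 * Real.exp (-ε ^ 2 / (2 * c)) := by
        linarith [hZ.measure_ge_le hε, hZ.neg.measure_ge_le hε]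

lemma measureReal_exists_lt_abs_le {ι : Type*} [Fintype ι] {Z : ι → Ω → ℝ} {c : NNReal} {ε : ℝ}
    [IsFiniteMeasure P] (hZ : ∀ j, HasSubgaussianMGF (Z j) c P) (hε : 0 ≤ ε) :
    P.real {ω | ∃ j, ε < |Z j ω|} ≤ Fintype.card ι * (2 * Real.exp (-ε ^ 2 / (2 * c))) := by
  have hunion : {ω | ∃ j, ε < |Z j ω|} = ⋃ j, {ω | ε < |Z j ω|} := by
    ext ω
    simp
  rw [hunion]
  refine (measureReal_iUnion_fintype_le _).trans ?_
  refine (Finset.sum_le_card_nsmul _ _ _ fun j _ => measureReal_lt_abs_le (hZ j) hε).trans_eq ?_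
  rw [nsmul_eq_mul, Finset.card_univ]

variable {n p : ℕ} {w : Ω → Fin n → ℝ} {σ : ℝ}

lemma hasSubgaussianMGF_correlation {X : Matrix (Fin n) (Fin p) ℝ}
    (hind : iIndepFun (fun i ω => w ω i) P)
    (hw : ∀ i, HasSubgaussianMGF (fun ω => w ω i) (σ ^ 2).toNNReal P) {j : Fin p}
    (hX : 1 / (n : ℝ) * ∑ i, X i j ^ 2 ≤ 2) :
    HasSubgaussianMGF (fun ω => ((1 / (n : ℝ)) • (Xᵀ *ᵥ w ω)) j)
      (2 * σ ^ 2 / n).toNNReal P := by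
  have hsum (ω : Ω) : ((1 / (n : ℝ)) • (Xᵀ *ᵥ w ω)) j = ∑ i, 1 / (n : ℝ) * X i j * w ω i := by
    simp only [Pi.smul_apply, Matrix.mulVec, dotProduct, Matrix.transpose_apply, smul_eq_mul,
      Finset.mul_sum, mul_assoc]
  simp only [hsum]
  refine hasSubgaussianMGF_sum_mul hind hw ?_
  rw [Real.coe_toNNReal _ (by positivity), Real.coe_toNNReal _ (by positivity)]
  calc (∑ i, (1 / (n : ℝ) * X i j) ^ 2) * σ ^ 2
      = σ ^ 2 / n * (1 / (n : ℝ) * ∑ i, X i j ^ 2) := by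
        simp only [mul_pow, ← Finset.mul_sum]
        ring
    _ ≤ σ ^ 2 / n * 2 := by gcongr
    _ = 2 * σ ^ 2 / n := by ring

lemma measureReal_exists_lt_abs_correlation_le [IsFiniteMeasure P] {X : Matrix (Fin n) (Fin p) ℝ}
    (hind : iIndepFun (fun i ω => w ω i) P)
    (hw : ∀ i, HasSubgaussianMGF (fun ω => w ω i) (σ ^ 2).toNNReal P)
    (hX : ∀ j, 1 / (n : ℝ) * ∑ i, X i j ^ 2 ≤ 2) (hn : 1 ≤ n) (hp : 2 ≤ p) (hσ : 0 < σ) :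
    P.real {ω | ∃ j, 4 * (σ * √(Real.log p / n)) < |((1 / (n : ℝ)) • (Xᵀ *ᵥ w ω)) j|} ≤
      (p : ℝ) ^ (-1 : ℝ) := by
  have : (0 : ℝ) < n := by exact_mod_cast hn
  have hp2 : (2 : ℝ) ≤ p := by exact_mod_cast hp
  have : 0 ≤ Real.log p := Real.log_nonneg (by linarith)
  have hexponent : -(4 * (σ * √(Real.log p / n))) ^ 2 / (2 * (2 * σ ^ 2 / n)) =
      Real.log p * (-4 : ℤ) := by
    rw [mul_pow, mul_pow, Real.sq_sqrt (by positivity)]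
    push_cast
    field_simp
    ring
  have hexp : Real.exp (-(4 * (σ * √(Real.log p / n))) ^ 2 / (2 * (2 * σ ^ 2 / n))) =
      (p : ℝ) ^ (-4 : ℤ) := by
    rw [hexponent, ← Real.rpow_def_of_pos (by linarith), Real.rpow_intCast]
  refine (measureReal_exists_lt_abs_le (fun j => hasSubgaussianMGF_correlation hind hw (hX j))
    (by positivity)).trans ?_
  rw [Fintype.card_fin, Real.coe_toNNReal _ (by positivity), hexp, Real.rpow_neg_one]
  calc (p : ℝ) * (2 * (p : ℝ) ^ (-4 : ℤ)) = 2 / (p : ℝ) ^ 2 * (p : ℝ)⁻¹ := by field_simp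
    _ ≤ 1 * (p : ℝ)⁻¹ := by
        gcongr
        rw [div_le_one (by positivity)]
        nlinarith
    _ = (p : ℝ)⁻¹ := one_mul _

lemma gaussianNoise_eq (n : ℕ) (σ : ℝ) :
    gaussianNoise n σ = Measure.pi fun _ => gaussianReal 0 (σ ^ 2).toNNReal := by
  rw [Real.toNNReal_of_nonneg (sq_nonneg σ)]
  rfl

lemma hasLaw_eval_gaussianNoise (hw : HasLaw w (gaussianNoise n σ) P) (i : Fin n) :
    HasLaw (fun ω => w ω i) (gaussianReal 0 (σ ^ 2).toNNReal) P := by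
  rw [gaussianNoise_eq] at hw
  exact (measurePreserving_eval _ i).fun_comp_hasLaw hw

lemma iIndepFun_of_hasLaw_gaussianNoise [IsProbabilityMeasure P]
    (hw : HasLaw w (gaussianNoise n σ) P) : iIndepFun (fun i ω => w ω i) P :=
  (iIndepFun_iff_hasLaw_pi_pi (hasLaw_eval_gaussianNoise hw)).2 (gaussianNoise_eq n σ ▸ hw)

end Noise

section Signals

variable {n p : ℕ} {σ : ℝ} {β : Fin p → ℝ} {j : Fin p}

lemma strongSignals_subset_vecSupport (n : ℕ) (σ : ℝ) (β : Fin p → ℝ) :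
    strongSignals n σ β ⊆ vecSupport β := Finset.filter_subset _ _

lemma kthLargestAbs_strongSignals_isGreatest (h : (strongSignals n σ β).Nonempty) :
    IsGreatest {x : ℝ | (strongSignals n σ β).card ≤ (Finset.univ.filter fun i => x ≤ |β i|).card}
      (minStrength n σ β) :=
  kthLargestAbs_isGreatest h.card_pos
    ((Finset.card_le_univ _).trans_eq (Fintype.card_fin p)) β

lemma minStrength_pos (h : (strongSignals n σ β).Nonempty) : 0 < minStrength n σ β := by
  obtain ⟨i, hi, hmin⟩ := Finset.exists_min_image _ (fun i => |β i|) h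
  have hi_pos : 0 < |β i| := abs_pos.2 (mem_vecSupport.1 (strongSignals_subset_vecSupport n σ β hi))
  refine hi_pos.trans_le ((kthLargestAbs_strongSignals_isGreatest h).2 ?_)
  exact Finset.card_le_card fun k hk => Finset.mem_filter.2 ⟨Finset.mem_univ _, hmin k hk⟩

/-- If `|β j|` were below the `s₁`-th largest value, the at least `s₁` components reaching that
value would all be strong signals other than `j`. -/
lemma minStrength_le (hj : j ∈ strongSignals n σ β) : minStrength n σ β ≤ |β j| := by
  by_contra! hlt
  have hsub : (Finset.univ.filter fun i => minStrength n σ β ≤ |β i|) ⊂ strongSignals n σ β := by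
    refine Finset.ssubset_iff_subset_ne.2 ⟨fun i hi => ?_, fun heq => ?_⟩
    · have hji : |β j| < |β i| := hlt.trans_le (Finset.mem_filter.1 hi).2
      have hi_ne : β i ≠ 0 := abs_pos.1 ((abs_nonneg _).trans_lt hji)
      exact Finset.mem_filter.2 ⟨mem_vecSupport.2 hi_ne, (Finset.mem_filter.1 hj).2.trans hji.le⟩
    · rw [← heq] at hj
      exact hlt.not_ge (Finset.mem_filter.1 hj).2
  exact (Finset.card_lt_card hsub).not_ge (kthLargestAbs_strongSignals_isGreatest ⟨j, hj⟩).1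

lemma abs_le_condNumber_mul_minStrength (h : (strongSignals n σ β).Nonempty) (j : Fin p) :
    |β j| ≤ condNumber n σ β * minStrength n σ β := by
  rw [condNumber, div_mul_cancel₀ _ (minStrength_pos h).ne']
  exact le_ciSup (f := fun i => |β i|) (Set.finite_range _).bddAbove j

lemma minStrength_le_condNumber_mul_minStrength (h : (strongSignals n σ β).Nonempty) :
    minStrength n σ β ≤ condNumber n σ β * minStrength n σ β := by
  obtain ⟨j, hj⟩ := h
  exact (minStrength_le hj).trans (abs_le_condNumber_mul_minStrength ⟨j, hj⟩ j)

lemma one_le_condNumber (h : (strongSignals n σ β).Nonempty) : 1 ≤ condNumber n σ β :=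
  one_le_of_le_mul_right₀ (minStrength_pos h) (minStrength_le_condNumber_mul_minStrength h)

lemma mem_vecSupport_hardThreshold {lam : ℝ} (hlam : 0 < lam) :
    j ∈ vecSupport (hardThreshold lam β) ↔ lam ≤ |β j| := by
  rw [mem_vecSupport, hardThreshold, ite_ne_right_iff, and_iff_left_iff_imp]
  exact fun h => abs_pos.1 (hlam.trans_le h)

lemma vecSupport_hardThreshold_eq {lam : ℝ} {v : Fin p → ℝ} {S : Finset (Fin p)}
    (hlam : 0 < lam) (hβ : ∀ j ∈ S, 2 * lam ≤ |β j|) (hS : ∀ j ∈ S, |v j - β j| ≤ |β j| / 2)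
    (hSc : ∀ j ∉ S, |v j| < lam) : vecSupport (hardThreshold lam v) = S := by
  ext j
  rw [mem_vecSupport_hardThreshold hlam]
  refine ⟨fun hj => by_contra fun hmem => (hSc j hmem).not_ge hj, fun hj => ?_⟩
  have := abs_sub_abs_le_abs_sub (β j) (v j)
  rw [abs_sub_comm] at this
  linarith [hβ j hj, hS j hj]

end Signals

section SelectionRegime

variable {n p : ℕ} {C σ δ α η : ℝ} {X : Matrix (Fin n) (Fin p) ℝ} {β : Fin p → ℝ}

/-- The assumptions (A), (B), (C) of the theorem, with explicit values of the constants `c_δ`,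
`c_α` and `c_η`. -/
structure SelectionRegime (C : ℝ) (X : Matrix (Fin n) (Fin p) ℝ) (β : Fin p → ℝ)
    (σ δ α η : ℝ) : Prop where
  noise_nonneg : 0 ≤ σ
  strong_nonempty : (strongSignals n σ β).Nonempty
  support_eq : vecSupport β = strongSignals n σ β ∪ weakSignals n σ β
  condNumber_mul_le : condNumber n σ β * minStrength n σ β ≤ C
  rip : RIP X ((vecSupport β).card + 1) δ
  isometry_le : δ ≤ 1 / 1000 /
    (condNumber n σ β * √((vecSupport β).card : ℝ) * Real.log (p / α))
  init_pos : 0 < α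
  init_le : α ≤ 1 / (4 * (1 + C)) / p
  step_pos : 0 < η
  step_le : η ≤ 1 / (1000 * (1 + C)) / (condNumber n σ β * Real.log (p / α))

namespace SelectionRegime

lemma minStrength_pos (h : SelectionRegime C X β σ δ α η) : 0 < minStrength n σ β :=
  _root_.minStrength_pos h.strong_nonempty

lemma one_le_condNumber (h : SelectionRegime C X β σ δ α η) : 1 ≤ condNumber n σ β :=
  _root_.one_le_condNumber h.strong_nonempty

lemma one_le_card_vecSupport (h : SelectionRegime C X β σ δ α η) : 1 ≤ (vecSupport β).card :=
  (h.strong_nonempty.mono (strongSignals_subset_vecSupport n σ β)).card_pos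

lemma one_le_dim (h : SelectionRegime C X β σ δ α η) : (1 : ℝ) ≤ p := by
  obtain ⟨j, -⟩ := h.strong_nonempty
  exact_mod_cast j.pos

lemma abs_le_of_notMem_strongSignals (h : SelectionRegime C X β σ δ α η) {j : Fin p}
    (hj : j ∉ strongSignals n σ β) : |β j| ≤ 2 * (σ * √(Real.log p / n)) := by
  by_cases hβj : β j = 0
  · have := h.noise_nonneg
    rw [hβj, abs_zero]
    positivity
  · have hweak : j ∈ weakSignals n σ β :=
      (Finset.mem_union.1 (h.support_eq ▸ mem_vecSupport.2 hβj)).resolve_left hj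
    rw [← mul_assoc]
    exact (Finset.mem_filter.1 hweak).2

lemma bound_pos (h : SelectionRegime C X β σ δ α η) : 0 < C :=
  h.minStrength_pos.trans_le
    ((minStrength_le_condNumber_mul_minStrength h.strong_nonempty).trans h.condNumber_mul_le)

lemma init_mul_dim_mul_le (h : SelectionRegime C X β σ δ α η) : α * p * (1 + C) ≤ 1 / 4 := by
  have hinit := h.init_le
  have := h.bound_pos
  have := h.one_le_dim
  rw [div_div, le_div_iff₀ (by positivity)] at hinit
  linarith

lemma init_mul_dim_le (h : SelectionRegime C X β σ δ α η) : α * p ≤ 1 / 4 := by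
  have := h.init_pos
  exact (le_mul_of_one_le_right (by positivity) (by linarith [h.bound_pos])).trans
    h.init_mul_dim_mul_le

lemma init_mul_le (h : SelectionRegime C X β σ δ α η) : α * (1 + C) ≤ 1 / 4 := by
  have := mul_nonneg h.init_pos.le (by linarith [h.bound_pos] : 0 ≤ 1 + C)
  linarith [le_mul_of_one_le_right this h.one_le_dim, h.init_mul_dim_mul_le]

lemma init_le_quarter (h : SelectionRegime C X β σ δ α η) : α ≤ 1 / 4 :=
  (le_mul_of_one_le_right h.init_pos.le h.one_le_dim).trans h.init_mul_dim_le

lemma one_le_log (h : SelectionRegime C X β σ δ α η) : 1 ≤ Real.log (p / α) := by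
  have hα := h.init_pos
  have hp := h.one_le_dim
  rw [Real.le_log_iff_exp_le (by positivity)]
  refine Real.exp_one_lt_d9.le.trans ?_
  rw [le_div_iff₀ hα]
  linarith [h.init_le_quarter]

lemma isometry_nonneg (h : SelectionRegime C X β σ δ α η) : 0 ≤ δ := by
  obtain ⟨j, -⟩ := h.strong_nonempty
  exact h.rip.nonneg (by omega) j

lemma slope_nonneg (h : SelectionRegime C X β σ δ α η) : 0 ≤ δ * √(vecSupport β).card :=
  mul_nonneg h.isometry_nonneg (Real.sqrt_nonneg _)

lemma slope_mul_condNumber_mul_log_le (h : SelectionRegime C X β σ δ α η) :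
    δ * √(vecSupport β).card * condNumber n σ β * Real.log (p / α) ≤ 1 / 1000 := by
  have := h.one_le_condNumber
  have := h.one_le_log
  have : 0 < √((vecSupport β).card : ℝ) :=
    Real.sqrt_pos.2 (by exact_mod_cast h.one_le_card_vecSupport)
  have hδ := h.isometry_le
  rw [le_div_iff₀ (by positivity)] at hδ
  linarith

lemma slope_mul_condNumber_le (h : SelectionRegime C X β σ δ α η) :
    δ * √(vecSupport β).card * condNumber n σ β ≤ 1 / 1000 :=
  (le_mul_of_one_le_right (mul_nonneg h.slope_nonneg (by linarith [h.one_le_condNumber]))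
    h.one_le_log).trans h.slope_mul_condNumber_mul_log_le

lemma slope_le (h : SelectionRegime C X β σ δ α η) : δ * √(vecSupport β).card ≤ 1 / 1000 :=
  (le_mul_of_one_le_right h.slope_nonneg h.one_le_condNumber).trans h.slope_mul_condNumber_le

lemma isometry_le_one (h : SelectionRegime C X β σ δ α η) : δ ≤ 1 := by
  have hs : 1 ≤ √((vecSupport β).card : ℝ) :=
    Real.one_le_sqrt.2 (by exact_mod_cast h.one_le_card_vecSupport)
  linarith [le_mul_of_one_le_right h.isometry_nonneg hs, h.slope_le]

lemma step_mul_condNumber_mul_le (h : SelectionRegime C X β σ δ α η) :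
    η * condNumber n σ β * (1 + C) ≤ 1 / 1000 := by
  have hκ := h.one_le_condNumber
  have hL := h.one_le_log
  have hC := h.bound_pos
  have hη := h.step_le
  rw [le_div_iff₀ (by positivity), le_div_iff₀ (by positivity)] at hη
  have hpos : 0 ≤ η * condNumber n σ β * (1 + C) := by
    have := h.step_pos
    positivity
  linarith [le_mul_of_one_le_right hpos hL]

lemma step_mul_le (h : SelectionRegime C X β σ δ α η) :
    η * (condNumber n σ β * minStrength n σ β) ≤ 1 / 1000 := by
  have hκ := h.one_le_condNumber
  have hm : minStrength n σ β ≤ 1 + C := by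
    linarith [minStrength_le_condNumber_mul_minStrength h.strong_nonempty, h.condNumber_mul_le]
  have hle := mul_le_mul_of_nonneg_left hm
    (mul_nonneg h.step_pos.le (by linarith) : 0 ≤ η * condNumber n σ β)
  linarith [h.step_mul_condNumber_mul_le]

lemma step_le_thousandth (h : SelectionRegime C X β σ δ α η) : η ≤ 1 / 1000 := by
  have hκ := le_mul_of_one_le_right h.step_pos.le h.one_le_condNumber
  have hC := le_mul_of_one_le_right (h.step_pos.le.trans hκ) (by linarith [h.bound_pos] : 1 ≤ 1 + C)
  linarith [h.step_mul_condNumber_mul_le]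

lemma step_mul_minStrength_pos (h : SelectionRegime C X β σ δ α η) : 0 < η * minStrength n σ β :=
  mul_pos h.step_pos h.minStrength_pos

lemma step_mul_minStrength_le (h : SelectionRegime C X β σ δ α η) : η * minStrength n σ β ≤ 1 :=
  (mul_le_mul_of_nonneg_left (minStrength_le_condNumber_mul_minStrength h.strong_nonempty)
    h.step_pos.le).trans (by linarith [h.step_mul_le])

variable {t : ℕ}

lemma tauLevel_nonneg (h : SelectionRegime C X β σ δ α η) : 0 ≤ tauLevel n p σ δ α :=
  (mul_nonneg h.isometry_nonneg h.init_pos.le).trans (le_max_left _ _)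

lemma tauLevel_le (h : SelectionRegime C X β σ δ α η)
    (ht : 16 * Real.log (p / α) / (η * minStrength n σ β) ≤ t)
    (ht' : t * (η * tauLevel n p σ δ α) ≤ 1 / 10000) :
    tauLevel n p σ δ α ≤ minStrength n σ β / 1000 := by
  have hm := h.minStrength_pos
  have hτ := h.tauLevel_nonneg
  rw [div_le_iff₀ h.step_mul_minStrength_pos] at ht
  have hle : 1 ≤ t * (η * minStrength n σ β) := by linarith [h.one_le_log]
  calc tauLevel n p σ δ α ≤ tauLevel n p σ δ α * (t * (η * minStrength n σ β)) :=
        le_mul_of_one_le_right hτ hle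
    _ = t * (η * tauLevel n p σ δ α) * minStrength n σ β := by ring
    _ ≤ 1 / 10000 * minStrength n σ β := by gcongr
    _ ≤ minStrength n σ β / 1000 := by linarith

lemma two_mul_init_sq_lt (h : SelectionRegime C X β σ δ α η) : 2 * α ^ 2 < 1 / p := by
  have hα := h.init_pos
  rw [lt_div_iff₀ (by linarith [h.one_le_dim])]
  calc 2 * α ^ 2 * p = 2 * α * (α * p) := by ring
    _ ≤ 2 * (1 / 4) * (1 / 4) := by
        gcongr
        exacts [h.init_le_quarter, h.init_mul_dim_le]
    _ < 1 := by norm_num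

lemma descentRegime (h : SelectionRegime C X β σ δ α η)
    (ht : 16 * Real.log (p / α) / (η * minStrength n σ β) ≤ t)
    (ht' : t * (η * tauLevel n p σ δ α) ≤ 1 / 10000)
    (hp : 1 / p ≤ σ * √(Real.log p / n)) :
    DescentRegime α η (minStrength n σ β) (condNumber n σ β * minStrength n σ β)
      (δ * √(vecSupport β).card) (8 * tauLevel n p σ δ α) where
  init_pos := h.init_pos
  init_le := by linarith [h.init_le_quarter]
  init_sq_le := by
    have hτ : σ * √(Real.log p / n) ≤ tauLevel n p σ δ α := le_max_right _ _
    linarith [h.two_mul_init_sq_lt, h.tauLevel_le ht ht', h.minStrength_pos, sq_nonneg α]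
  min_pos := h.minStrength_pos
  min_le := minStrength_le_condNumber_mul_minStrength h.strong_nonempty
  step_pos := h.step_pos
  step_le := by linarith [h.step_le_thousandth]
  step_mul_le := h.step_mul_le
  slope_nonneg := h.slope_nonneg
  slope_le := h.slope_le
  slope_mul_le := by
    have := mul_le_mul_of_nonneg_right h.slope_mul_condNumber_le h.minStrength_pos.le
    linarith [h.minStrength_pos]
  noise_nonneg := mul_nonneg (by norm_num) h.tauLevel_nonneg
  noise_le := by linarith [h.tauLevel_le ht ht', h.minStrength_pos]

/-- The first time of the window, after which strong coordinates have reached half of their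
target. -/
noncomputable def growthTime (n : ℕ) (σ : ℝ) (β : Fin p → ℝ) (α η : ℝ) : ℕ :=
  ⌈16 * Real.log (p / α) / (η * minStrength n σ β)⌉₊

lemma le_strongLevel_growthTime_sq (h : SelectionRegime C X β σ δ α η) :
    2 * (condNumber n σ β * minStrength n σ β) + α ^ 2 ≤
      strongLevel α η (minStrength n σ β) (growthTime n σ β α η) ^ 2 := by
  have hα := h.init_pos
  have hp := h.one_le_dim
  have hC := h.bound_pos
  have hle : 4 * (1 + C) ≤ strongLevel α η (minStrength n σ β) (growthTime n σ β α η) := by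
    refine le_trans ?_ (sq_div_le_strongLevel hα (by linarith : (0 : ℝ) < p)
      h.step_mul_minStrength_pos h.step_mul_minStrength_le (Nat.le_ceil _))
    rw [le_div_iff₀ hα]
    nlinarith [h.init_mul_le]
  nlinarith [h.condNumber_mul_le, h.init_le_quarter]

lemma mul_sum_gradErrBound_le_one (h : SelectionRegime C X β σ δ α η)
    (ht : 16 * Real.log (p / α) / (η * minStrength n σ β) ≤ t)
    (ht' : t * (η * tauLevel n p σ δ α) ≤ 1 / 10000)
    (hp : 1 / p ≤ σ * √(Real.log p / n)) :
    η * ∑ v ∈ Finset.range t, gradErrBound η (minStrength n σ β)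
      (condNumber n σ β * minStrength n σ β) (δ * √(vecSupport β).card)
      (8 * tauLevel n p σ δ α) (growthTime n σ β α η) v ≤ 1 := by
  have hκ := h.one_le_condNumber
  have hε := h.slope_nonneg
  have hηm := h.step_mul_minStrength_pos
  have hL := h.one_le_log
  have hT₁ : η * minStrength n σ β * growthTime n σ β α η ≤ 16 * Real.log (p / α) + 1 := by
    have hceil := (Nat.ceil_lt_add_one (by positivity :
      0 ≤ 16 * Real.log (p / α) / (η * minStrength n σ β))).le
    rw [div_add_one hηm.ne', le_div_iff₀ hηm] at hceil
    rw [growthTime]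
    linarith [h.step_mul_minStrength_le]
  refine ((h.descentRegime ht ht' hp).mul_sum_gradErrBound_le _ t).trans ?_
  rw [mul_div_cancel_right₀ _ h.minStrength_pos.ne']
  have hgrowth : δ * √(vecSupport β).card * condNumber n σ β *
      (η * minStrength n σ β * growthTime n σ β α η + 2) ≤ 19 / 1000 :=
    calc _ ≤ δ * √(vecSupport β).card * condNumber n σ β * (19 * Real.log (p / α)) := by
          gcongr
          linarith
      _ ≤ 19 / 1000 := by linarith [h.slope_mul_condNumber_mul_log_le]
  have hnoise : (4 * (δ * √(vecSupport β).card) + 1) * (t * (η * (8 * tauLevel n p σ δ α))) ≤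
      2 * (8 / 10000) := by
    have := h.step_pos
    have := h.tauLevel_nonneg
    gcongr
    · linarith [h.slope_le]
    · linarith
  linarith

end SelectionRegime

end SelectionRegime

section GradientDescent

variable {n p : ℕ} {C σ δ α η : ℝ} {X : Matrix (Fin n) (Fin p) ℝ} {β : Fin p → ℝ}
  {y w : Fin n → ℝ} {t u : ℕ} {j : Fin p}

/-- The factors `g + l` and `g - l` of the iterates, in which gradient descent is multiplicative
and `g * l` is `hadamardValue`. -/
noncomputable def gdCoordinates (X : Matrix (Fin n) (Fin p) ℝ) (y : Fin n → ℝ) (α η : ℝ) (u : ℕ)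
    (j : Fin p) : ℝ × ℝ :=
  ((gdIterate X y α η u).1 j + (gdIterate X y α η u).2 j,
    (gdIterate X y α η u).1 j - (gdIterate X y α η u).2 j)

/-- The gradient `n⁻¹ Xᵀ (X β_u - y)` of the squared loss at the estimator `β_u`. -/
noncomputable def gdGradient (X : Matrix (Fin n) (Fin p) ℝ) (y : Fin n → ℝ) (α η : ℝ) (u : ℕ) :
    Fin p → ℝ :=
  residualGrad X y (gdIterate X y α η u).1 (gdIterate X y α η u).2

lemma hadamardValue_gdCoordinates :
    hadamardValue (gdCoordinates X y α η u j) = gdEstimator X y α η u j := by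
  simp only [hadamardValue, gdCoordinates, gdEstimator, Pi.mul_apply]
  ring

lemma gdCoordinates_zero : gdCoordinates X y α η 0 j = (α, α) := by
  simp [gdCoordinates, gdIterate]

lemma gdCoordinates_succ : gdCoordinates X y α η (u + 1) j =
    hadamardStep η (gdGradient X y α η u j) (gdCoordinates X y α η u j) := by
  simp only [gdCoordinates, gdIterate, gdGradient, hadamardStep, Pi.sub_apply, Pi.smul_apply,
    Pi.mul_apply, smul_eq_mul, Prod.mk.injEq]
  constructor <;> ring

namespace SelectionRegime

lemma abs_gdGradient_sub_le (h : SelectionRegime C X β σ δ α η) {D : ℝ} (hD0 : 0 ≤ D)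
    (hD : ∀ i ∈ strongSignals n σ β, |gdEstimator X (X *ᵥ β + w) α η u i - β i| ≤ D)
    (hnull : ∀ i ∉ strongSignals n σ β, |gdEstimator X (X *ᵥ β + w) α η u i| ≤ 2 * α ^ 2)
    (hw : |((1 / (n : ℝ)) • (Xᵀ *ᵥ w)) j| ≤ 4 * (σ * √(Real.log p / n))) :
    |gdGradient X (X *ᵥ β + w) α η u j - (gdEstimator X (X *ᵥ β + w) α η u j -
      (strongSignals n σ β : Set (Fin p)).indicator β j)| ≤
      δ * √(vecSupport β).card * D + 8 * tauLevel n p σ δ α := by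
  have hτ₁ : δ * α ≤ tauLevel n p σ δ α := le_max_left _ _
  have hτ₂ : σ * √(Real.log p / n) ≤ tauLevel n p σ δ α := le_max_right _ _
  have hσ : 0 ≤ σ * √(Real.log p / n) := mul_nonneg h.noise_nonneg (Real.sqrt_nonneg _)
  have hweak : δ * √(vecSupport β).card * (σ * √(Real.log p / n)) ≤
      1 / 1000 * (σ * √(Real.log p / n)) := mul_le_mul_of_nonneg_right h.slope_le hσ
  have hinit : δ * α * (α * p) ≤ δ * α * (1 / 4) :=
    mul_le_mul_of_nonneg_left h.init_mul_dim_le (mul_nonneg h.isometry_nonneg h.init_pos.le)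
  refine (h.rip.abs_residualGrad_sub_le h.one_le_card_vecSupport
    (Finset.coe_subset.2 (strongSignals_subset_vecSupport n σ β))
    (fun i => h.abs_le_of_notMem_strongSignals) hD hnull hD0 (by positivity) (by positivity) j
    hw).trans ?_
  linarith [h.tauLevel_nonneg]

lemma perturbedDescent (h : SelectionRegime C X β σ δ α η)
    (hw : ∀ j, |((1 / (n : ℝ)) • (Xᵀ *ᵥ w)) j| ≤ 4 * (σ * √(Real.log p / n))) :
    PerturbedDescent (strongSignals n σ β) ((strongSignals n σ β : Set (Fin p)).indicator β) α η
      (minStrength n σ β) (condNumber n σ β * minStrength n σ β)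
      (δ * √(vecSupport β).card) (8 * tauLevel n p σ δ α)
      (gdCoordinates X (X *ᵥ β + w) α η)
      (fun u j => gdGradient X (X *ᵥ β + w) α η u j - (gdEstimator X (X *ᵥ β + w) α η u j -
        (strongSignals n σ β : Set (Fin p)).indicator β j)) where
  zero _ := gdCoordinates_zero
  succ u j := by rw [hadamardValue_gdCoordinates, add_sub_cancel, gdCoordinates_succ]
  target_eq_zero j hj := Set.indicator_of_notMem hj β
  le_target j hj := by
    rw [Set.indicator_of_mem hj]
    exact minStrength_le hj
  target_le j hj := by
    rw [Set.indicator_of_mem hj]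
    exact abs_le_condNumber_mul_minStrength h.strong_nonempty j
  err_le u D hD0 hD hnull j := by
    simp only [hadamardValue_gdCoordinates] at hD hnull
    refine h.abs_gdGradient_sub_le hD0 (fun i hi => ?_) hnull (hw j)
    simpa only [Set.indicator_of_mem (Finset.mem_coe.2 hi)] using hD i hi

theorem vecSupport_hardThreshold_gdEstimator_eq (h : SelectionRegime C X β σ δ α η)
    (ht : 16 * Real.log (p / α) / (η * minStrength n σ β) ≤ t)
    (ht' : t * (η * tauLevel n p σ δ α) ≤ 1 / 10000)
    (hw : ∀ j, |((1 / (n : ℝ)) • (Xᵀ *ᵥ w)) j| ≤ 4 * (σ * √(Real.log p / n)))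
    {lam : ℝ} (hlam : 1 / p ≤ lam) (hlam' : lam ≤ σ * √(Real.log p / n)) :
    vecSupport (hardThreshold lam (gdEstimator X (X *ᵥ β + w) α η t)) =
      strongSignals n σ β := by
  have hp : 1 / p ≤ σ * √(Real.log p / n) := hlam.trans hlam'
  have hregime := h.descentRegime ht ht' hp
  have hdescent := h.perturbedDescent hw
  have hsum := h.mul_sum_gradErrBound_le_one ht ht' hp
  refine vecSupport_hardThreshold_eq (β := β)
    (hlam.trans_lt' (one_div_pos.2 (by linarith [h.one_le_dim])))
    (fun j hj => ?_) (fun j hj => ?_) (fun j hj => ?_)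
  · have hlam_le : lam ≤ tauLevel n p σ δ α := hlam'.trans (le_max_right _ _)
    linarith [h.tauLevel_le ht ht', minStrength_le hj, h.minStrength_pos]
  · have hclose := hdescent.abs_hadamardValue_sub_le hregime h.le_strongLevel_growthTime_sq
      (Nat.ceil_le.2 ht) hsum hj
    rwa [hadamardValue_gdCoordinates, Set.indicator_of_mem (Finset.mem_coe.2 hj)] at hclose
  · have hsmall := hdescent.abs_hadamardValue_le hregime h.le_strongLevel_growthTime_sq hsum hj
    rw [hadamardValue_gdCoordinates] at hsmall
    exact hsmall.trans_lt (h.two_mul_init_sq_lt.trans_le hlam)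

lemma measureReal_exists_lt_abs_correlation_le {Ω : Type*} [MeasurableSpace Ω] {P : Measure Ω}
    [IsFiniteMeasure P] {w : Ω → Fin n → ℝ} (h : SelectionRegime C X β σ δ α η)
    (hind : iIndepFun (fun i ω => w ω i) P)
    (hw : ∀ i, HasSubgaussianMGF (fun ω => w ω i) (σ ^ 2).toNNReal P) (hn : 1 ≤ n)
    (hp : 1 / p ≤ σ * √(Real.log p / n)) :
    P.real {ω | ∃ j, 4 * (σ * √(Real.log p / n)) < |((1 / (n : ℝ)) • (Xᵀ *ᵥ w ω)) j|} ≤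
      (p : ℝ) ^ (-1 : ℝ) := by
  have hlevel : 0 < σ * √(Real.log p / n) :=
    hp.trans_lt' (one_div_pos.2 (by linarith [h.one_le_dim]))
  have hp_one : p ≠ 1 := by
    rintro rfl
    simp at hlevel
  have hp_pos : 1 ≤ p := by exact_mod_cast h.one_le_dim
  refine _root_.measureReal_exists_lt_abs_correlation_le hind hw (fun j => ?_) hn (by omega)
    (pos_of_mul_pos_left hlevel (Real.sqrt_nonneg _))
  linarith [h.rip.column_le (by omega) j, h.isometry_le_one]

end SelectionRegime

end GradientDescent

theorem mainTheorem3_general {n p : ℕ} {C σ δ α η : ℝ} {X : Matrix (Fin n) (Fin p) ℝ}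
    {β : Fin p → ℝ} {t : ℕ} {Ω : Type*} [MeasurableSpace Ω] {P : Measure Ω}
    [IsProbabilityMeasure P] {w : Ω → Fin n → ℝ} (hn : 1 ≤ n)
    (h : SelectionRegime C X β σ δ α η) (hind : iIndepFun (fun i ω => w ω i) P)
    (hw : ∀ i, HasSubgaussianMGF (fun ω => w ω i) (σ ^ 2).toNNReal P)
    (ht : 16 * Real.log (p / α) / (η * minStrength n σ β) ≤ t)
    (ht' : t * (η * tauLevel n p σ δ α) ≤ 1 / 10000) :
    1 - (p : ℝ) ^ (-1 : ℝ) ≤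
      P.real {ω | ∀ lam : ℝ, 1 / p ≤ lam → lam ≤ σ * √(Real.log p / n) →
        vecSupport (hardThreshold lam (gdEstimator X (X *ᵥ β + w ω) α η t)) =
          strongSignals n σ β} := by
  set good := {ω | ∀ lam : ℝ, 1 / p ≤ lam → lam ≤ σ * √(Real.log p / n) →
    vecSupport (hardThreshold lam (gdEstimator X (X *ᵥ β + w ω) α η t)) = strongSignals n σ β}
  by_cases hp : 1 / p ≤ σ * √(Real.log p / n)
  · have hbad := h.measureReal_exists_lt_abs_correlation_le hind hw hn hp
    set bad := {ω | ∃ j, 4 * (σ * √(Real.log p / n)) < |((1 / (n : ℝ)) • (Xᵀ *ᵥ w ω)) j|}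
    have hcover : good ∪ bad = Set.univ := by
      refine Set.eq_univ_of_forall fun ω => or_iff_not_imp_right.2 fun hω lam hlam hlam' => ?_
      simp only [bad, Set.mem_ofPred_eq, not_exists, not_lt] at hω
      exact h.vecSupport_hardThreshold_gdEstimator_eq ht ht' hω hlam hlam'
    have hone : 1 ≤ P.real good + P.real bad := by
      rw [← probReal_univ (μ := P), ← hcover]
      exact measureReal_union_le _ _
    linarith
  · have hgood : good = Set.univ :=
      Set.eq_univ_of_forall fun ω lam hlam hlam' => absurd (hlam.trans hlam') hp
    rw [hgood, probReal_univ, sub_le_self_iff]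
    positivity

theorem mainTheorem3 :
    ∀ C : ℝ, 0 < C →
    ∃ cδ cα cη c₁ c₂ c₃ c₄ c₁₀ c₁₁ : ℝ,
      0 < cδ ∧ 0 < cα ∧ 0 < cη ∧ 0 < c₁ ∧ 0 < c₂ ∧ 0 < c₃ ∧ 0 < c₄ ∧ 0 < c₁₀ ∧ 0 < c₁₁ ∧
      ∀ (n p : ℕ), 1 ≤ n → 1 ≤ p →
      ∀ (X : Matrix (Fin n) (Fin p) ℝ) (βstar : Fin p → ℝ) (σ δ α η : ℝ),
        0 ≤ σ →
        (strongSignals n σ βstar).Nonempty →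
        -- Assumption (A)
        vecSupport βstar = strongSignals n σ βstar ∪ weakSignals n σ βstar →
        (vecSupport βstar).card = (strongSignals n σ βstar).card + (weakSignals n σ βstar).card →
        condNumber n σ βstar * minStrength n σ βstar ≤ C →
        -- Assumption (B)
        RIP X ((vecSupport βstar).card + 1) δ →
        δ ≤ cδ / (condNumber n σ βstar * Real.sqrt ((vecSupport βstar).card : ℝ)
              * Real.log (p / α)) →
        -- Assumption (C)
        0 < α → α ≤ cα / p →
        0 < η → η ≤ cη / (condNumber n σ βstar * Real.log (p / α)) →
      ∀ (Ω : Type*) [MeasurableSpace Ω] (P : Measure Ω) [IsProbabilityMeasure P]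
        (w : Ω → Fin n → ℝ), HasLaw w (gaussianNoise n σ) P →
      -- the early-stopping window `c₁ log(p/α)/(η m) ≤ t ≤ c₂/(η τ)` (no upper limit if `τ = 0`)
      ∀ t : ℕ,
        c₁ * Real.log (p / α) / (η * minStrength n σ βstar) ≤ (t : ℝ) →
        (t : ℝ) * (η * tauLevel n p σ δ α) ≤ c₂ →
        1 - (p : ℝ) ^ (-c₃) - (n : ℝ) ^ (-c₄) ≤
          P.real {ω | ∀ lam : ℝ, c₁₀ / p ≤ lam →
            lam ≤ c₁₁ * σ * Real.sqrt (Real.log p / n) →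
            vecSupport (hardThreshold lam (gdEstimator X (X *ᵥ βstar + w ω) α η t)) =
              strongSignals n σ βstar} := by
  intro C hC
  refine ⟨1 / 1000, 1 / (4 * (1 + C)), 1 / (1000 * (1 + C)), 16, 1 / 10000, 1, 1, 1, 1,
    by norm_num, by positivity, by positivity, by norm_num, by norm_num, by norm_num, by norm_num,
    by norm_num, by norm_num, ?_⟩
  intro n p hn _ X β σ δ α η hσ hS hA _ hκm hX hδ hα hα_le hη hη_le Ω _ P _ w hw t ht ht'
  rw [one_mul]
  exact (sub_le_self _ (by positivity)).trans (mainTheorem3_general hn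
    ⟨hσ, hS, hA, hκm, hX, hδ, hα, hα_le, hη, hη_le⟩ (iIndepFun_of_hasLaw_gaussianNoise hw)
    (fun i => hasSubgaussianMGF_of_hasLaw_gaussianReal (hasLaw_eval_gaussianNoise hw i)) ht ht')
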